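/- Let $B_n(x)$ be the $n$-th Bernoulli polynomial and $B_n=B_n(0)$ the $n$-th Bernoulli number. For $f(x)\in\mathbb{Q}[x]$ let $\operatorname{denom}(f(x))$ be the smallest integer $d\ge 1$ such that $d\cdot f(x)\in\mathbb{Z}[x]$, and for $n\ge 1$ put $\mathfrak{D}_n:=\operatorname{denom}\bigl(B_n(x)-B_n\bigr)$. For odd $n\ge 1$, the quotients $$\frac{\mathfrak{D}_n}{\mathfrak{D}_{n+1}} = 1, 2, 3, 2, 5, 3, 7, 2, 3, 5, 11, 1, 13, 7, 15, 2, 17, 3, 19, 5, 7, \dots \qquad (n=1,3,5,\dots,41,\dots)$$ are odd integers, except that $$\frac{\mathfrak{D}_n}{\mathfrak{D}_{n+1}} = 2 \iff n = 2^k-1 \text{ for some integer } k\ge 2.$$ Moreover, let $p$ be an odd prime. For all integers $k,\ell\ge 1$ and $n=2^\ell p^k-1$ we have $$\frac{\mathfrak{D}_n}{\mathfrak{D}_{n+1}}\in\{1,p\}.$$ More precisely, the quotient equals $p$ whenever $k\ge 1$ and $1\le \ell<\log_2 p$; and there is a positive integer $L_p>\log_2 p$, depending only on $p$, such that the quotient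 equals $1$ whenever $k\ge 1$ and $\ell\ge L_p$. -/

import Mathlib

open Polynomial

/-- A natural number `d ≥ 1` clears the denominators of `f ∈ ℚ[x]` if `d · f(x) ∈ ℤ[x]`. -/
def ClearsDenom (f : ℚ[X]) (d : ℕ) : Prop :=
  0 < d ∧ ∃ g : ℤ[X], g.map (Int.castRingHom ℚ) = C (d : ℚ) * f

/-- The denominator of a polynomial `f ∈ ℚ[x]`: the smallest `d ≥ 1` with `d · f(x) ∈ ℤ[x]`. -/
noncomputable def polyDenom (f : ℚ[X]) : ℕ :=
  sInf {d : ℕ | ClearsDenom f d}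

/-- The infimum in the definition of `polyDenom` is always attained. -/
theorem polyDenom_isLeast (f : ℚ[X]) : IsLeast {d : ℕ | ClearsDenom f d} (polyDenom f) := by
  have hne : {d : ℕ | ClearsDenom f d}.Nonempty := by
    obtain ⟨b, hb, h⟩ := IsLocalization.integerNormalization_spec (nonZeroDivisors ℤ) f
    have hb0 : b ≠ 0 := nonZeroDivisors.ne_zero hb
    have h' : (IsLocalization.integerNormalization (nonZeroDivisors ℤ) f).map
        (Int.castRingHom ℚ) = C (b : ℚ) * f := by
      have h2 : (b • f : ℚ[X]) = C (b : ℚ) * f := by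
        rw [zsmul_eq_mul]; simp
      rw [← h2]; exact h
    refine ⟨b.natAbs, Int.natAbs_pos.mpr hb0, ?_⟩
    rcases Int.natAbs_eq b with hb' | hb'
    · refine ⟨_, h'.trans ?_⟩
      have h3 : (b : ℚ) = (b.natAbs : ℚ) := by
        simpa using congrArg (Int.cast : ℤ → ℚ) hb'
      rw [h3]
    · refine ⟨-(IsLocalization.integerNormalization (nonZeroDivisors ℤ) f), ?_⟩
      have h3 : (b : ℚ) = -(b.natAbs : ℚ) := by
        simpa using congrArg (Int.cast : ℤ → ℚ) hb'
      rw [Polynomial.map_neg, h', h3]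
      simp
  exact ⟨Nat.sInf_mem hne, fun d hd => Nat.sInf_le hd⟩

/-- The denominator `𝔇 n` of the polynomial `B_n(x) - B_n`, where `B_n(x)` is the `n`-th
Bernoulli polynomial and `B_n = B_n(0)` the `n`-th Bernoulli number. -/
noncomputable def bernDenom (n : ℕ) : ℕ :=
  polyDenom (Polynomial.bernoulli n - C (_root_.bernoulli n))

/-- The quotient `𝔇 n / 𝔇 (n + 1)`, as a rational number. -/
noncomputable def bernDenomRatio (n : ℕ) : ℚ :=
  (bernDenom n : ℚ) / (bernDenom (n + 1) : ℚ)

/-! Write `s_q(n)` for the base-`q` digit sum. By von Staudt–Clausen and Legendre's formula, `𝔇_n`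
is the product of the primes `q` with `s_q(n) ≥ q` (`bernDenom_eq_prod`). For odd `n` it follows
that `𝔇_n / 𝔇_{n+1}` is the product of the primes `q ∣ n + 1` with `s_q(n + 1) < q ≤ s_q(n)`
(`bernDenomRatio_eq_prod`). The prime 2 occurs exactly when `n + 1` is a power of 2 that is at least
4. If `n + 1 = 2^ℓ p^k`, only `p` can occur, and it does iff `s_p(2^ℓ) < p`. This holds when `2^ℓ <
p`, so what remains is that `s_p(2^ℓ)` tends to infinity with `ℓ`
(`finite_setOf_digitSum_two_pow_le`).

If `s_p(2^ℓ)` is bounded, one of finitely many long windows of digit positions contains only zeros,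
so `2^ℓ = X p^a + Y` with `X` tiny and `Y` much smaller than `2^ℓ`. That this happens finitely often
(`finite_nearMultiples`) is a Thue-type gap argument. Two solutions with `ℓ₂` far larger than `ℓ₁`
give rationals `ξ = X₁ p^a₁ / 2^ℓ₁` and `ζ = X₂ p^a₂ / 2^ℓ₂` close to 1. For suitable `ν ≈ ℓ₂ / ℓ₁`,
the powers of 2 and `p` nearly cancel in `η = ξ^ν / ζ`, which thus has small denominator and is
close to `ξ^ν`. A divided difference of `i + ν j ↦ ξ^i η^j` is then nonzero with controlled
denominator, yet tiny, since this function nearly equals `e ↦ ξ^e`, whose divided difference of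
order `n` has size about `(1 - ξ)^n`. -/

/-! ### Divided differences on a union of intervals -/

/-- The coefficient of `f e` in the divided difference of `f` at the nodes `E`. -/
noncomputable def dividedCoeff (E : Finset ℕ) (e : ℕ) : ℚ :=
  (∏ e' ∈ E.erase e, ((e : ℚ) - e'))⁻¹

/-- The union of the `k` intervals `[ν j, ν j + w)`, `j < k`. -/
def blocks (ν w k : ℕ) : Finset ℕ :=
  (Finset.range w ×ˢ Finset.range k).image fun x => x.1 + ν * x.2

/-- This is the top coefficient in Lagrange's formula; in particular the divided difference kills
polynomials of degree below `E.card - 1`. -/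
theorem sum_eval_mul_dividedCoeff {E : Finset ℕ} {P : ℚ[X]} (hP : P.degree < (E.card : ℕ)) :
    ∑ e ∈ E, P.eval (e : ℚ) * dividedCoeff E e = P.coeff (E.card - 1) := by
  rw [Lagrange.coeff_eq_sum (s := E) (v := fun e : ℕ => (e : ℚ))
    (fun a _ b _ h => Nat.cast_injective h) hP]
  exact Finset.sum_congr rfl fun e _ => by rw [dividedCoeff, div_eq_mul_inv]

theorem blocks_injOn {ν w k : ℕ} (h : w ≤ ν) :
    Set.InjOn (fun x : ℕ × ℕ => x.1 + ν * x.2) (Finset.range w ×ˢ Finset.range k : Finset _) := by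
  rintro ⟨i, j⟩ hx ⟨i', j'⟩ hy hxy
  simp only [Finset.coe_product, Set.mem_prod, Finset.coe_range, Set.mem_Iio] at hx hy hxy
  have h1 : i = i' := by
    have := congrArg (· % ν) hxy
    simpa [Nat.mod_eq_of_lt (hx.1.trans_le h), Nat.mod_eq_of_lt (hy.1.trans_le h)] using this
  subst h1
  have : 0 < ν := by omega
  simpa [this.ne'] using hxy

theorem card_blocks {ν w k : ℕ} (h : w ≤ ν) : (blocks ν w k).card = k * w := by
  rw [blocks, Finset.card_image_of_injOn (blocks_injOn h)]
  simp [mul_comm]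

theorem lt_of_mem_blocks {ν w k e : ℕ} (h : w ≤ ν) (he : e ∈ blocks ν w k) : e < k * ν := by
  simp only [blocks, Finset.mem_image, Finset.mem_product, Finset.mem_range, Prod.exists] at he
  obtain ⟨i, j, ⟨hi, hj⟩, rfl⟩ := he
  have : ν * (j + 1) ≤ ν * k := Nat.mul_le_mul_left _ hj
  nlinarith

/-- The divided differences of `i + ν j ↦ ξ ^ i * η ^ j` over the blocks do not all vanish. -/
theorem exists_dividedDifference_ne_zero {ξ η : ℚ} (hξ1 : ξ ≠ 1) {ν w k : ℕ}
    (hw : w < ν) (hk : 0 < k) :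
    ∃ E ⊆ blocks ν (w + 1) k, E.card = k * w + 1 ∧
      ∑ e ∈ E, ξ ^ (e % ν) * η ^ (e / ν) * dividedCoeff E e ≠ 0 := by
  by_contra! hall
  have hcast : ∀ s : Finset ℕ, Set.InjOn (fun e : ℕ => (e : ℚ)) s :=
    fun s a _ b _ h => Nat.cast_injective h
  set g : ℕ → ℚ := fun e => ξ ^ (e % ν) * η ^ (e / ν) with hg
  have hcard : (blocks ν (w + 1) k).card = k * (w + 1) := card_blocks hw
  -- Interpolate on any `k * w` nodes. Vanishing of the divided difference on `E₀ ∪ {f}` means that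
  -- the node `f` does not raise the degree, so the same `G` interpolates on all the blocks.
  obtain ⟨E₀, hE₀, hE₀c⟩ := Finset.exists_subset_card_eq (s := blocks ν (w + 1) k) (n := k * w)
    (by rw [hcard]; gcongr; omega)
  set G : ℚ[X] := Lagrange.interpolate E₀ (fun e : ℕ => (e : ℚ)) g with hG
  have hGdeg : G.degree < (k * w : ℕ) := by
    rw [← hE₀c]; exact Lagrange.degree_interpolate_lt _ (hcast _)
  have hGeval : ∀ f ∈ blocks ν (w + 1) k, G.eval (f : ℚ) = g f := by
    intro f hf
    by_cases hfE : f ∈ E₀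
    · exact Lagrange.eval_interpolate_at_node g (hcast _) hfE
    set E := insert f E₀ with hE
    have hEc : E.card = k * w + 1 := by rw [hE, Finset.card_insert_of_notMem hfE, hE₀c]
    set H : ℚ[X] := Lagrange.interpolate E (fun e : ℕ => (e : ℚ)) g with hH
    have hHe : ∀ e ∈ E, H.eval (e : ℚ) = g e :=
      fun e he => Lagrange.eval_interpolate_at_node g (hcast _) he
    have hHdeg : H.degree < (E.card : ℕ) := Lagrange.degree_interpolate_lt _ (hcast _)
    have hHc : H.coeff (k * w) = 0 := by
      have h1 := sum_eval_mul_dividedCoeff hHdeg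
      rw [hEc, Nat.add_sub_cancel] at h1
      rw [← h1, ← hall E (Finset.insert_subset hf hE₀) hEc]
      exact Finset.sum_congr rfl fun e he => by rw [hHe e he]
    have hHdeg' : H.degree < (k * w : ℕ) := by
      rw [Polynomial.degree_lt_iff_coeff_zero]
      intro m hm
      rcases hm.eq_or_lt with rfl | hm
      · exact hHc
      · refine Polynomial.coeff_eq_zero_of_degree_lt (hHdeg.trans_le ?_)
        rw [hEc]; exact_mod_cast hm
    have hGH : H = G := by
      refine Polynomial.eq_of_degrees_lt_of_eval_index_eq E₀ (hcast _) (by rwa [hE₀c])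
        (by rwa [hE₀c]) fun e he => ?_
      rw [hHe e (Finset.mem_insert_of_mem he)]
      exact (Lagrange.eval_interpolate_at_node g (hcast _) he).symm
    rw [← hGH, hHe f (Finset.mem_insert_self _ _)]
  have hsub : ∀ e ∈ blocks ν w k, e ∈ blocks ν (w + 1) k ∧ e + 1 ∈ blocks ν (w + 1) k ∧
      g (e + 1) = ξ * g e := by
    intro e he
    simp only [blocks, Finset.mem_image, Finset.mem_product, Finset.mem_range, Prod.exists] at he ⊢
    obtain ⟨i, j, ⟨hi, hj⟩, rfl⟩ := he
    refine ⟨⟨i, j, ⟨by omega, hj⟩, rfl⟩, ⟨i + 1, j, ⟨by omega, hj⟩, by ring⟩, ?_⟩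
    have hν : 0 < ν := by omega
    have e1 : i + ν * j + 1 = (i + 1) + ν * j := by ring
    rw [hg, e1]
    simp only [Nat.add_mul_mod_self_left, Nat.add_mul_div_left _ _ hν]
    rw [Nat.mod_eq_of_lt (by omega : i + 1 < ν), Nat.mod_eq_of_lt (by omega : i < ν),
      Nat.div_eq_of_lt (by omega : i + 1 < ν), Nat.div_eq_of_lt (by omega : i < ν)]
    ring
  have hcomp : (G.comp (X + C 1)).degree = G.degree := by
    rw [← Polynomial.taylor_apply, Polynomial.degree_taylor]
  -- On the blocks shortened by one, both `e` and `e + 1` are nodes, and these `k * w` points exceed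
  -- the degree. Comparing leading coefficients then forces `G = 0`, against the value 1 at node 0.
  have hQ : G.comp (X + C 1) = C ξ * G := by
    refine Polynomial.eq_of_degrees_lt_of_eval_index_eq (blocks ν w k) (hcast _)
      (by rwa [card_blocks hw.le, hcomp]) ?_ fun e he => ?_
    · rw [card_blocks hw.le]
      rw [← Polynomial.smul_eq_C_mul]
      exact (Polynomial.degree_smul_le _ _).trans_lt hGdeg
    · obtain ⟨h1, h2, h3⟩ := hsub e he
      simp only [eval_comp, eval_add, eval_X, eval_C, eval_mul]
      rw [hGeval e h1, ← h3, ← hGeval _ h2]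
      push_cast; rfl
  have hlc : G.leadingCoeff = ξ * G.leadingCoeff := by
    have h1 := congrArg (fun P : ℚ[X] => P.coeff G.natDegree) hQ
    simp only [coeff_C_mul] at h1
    have h2 : (G.comp (X + C 1)).natDegree = G.natDegree :=
      Polynomial.natDegree_eq_of_degree_eq hcomp
    have h3 : (G.comp (X + C 1)).leadingCoeff = G.leadingCoeff := by
      rw [← Polynomial.taylor_apply, Polynomial.leadingCoeff_taylor]
    rw [Polynomial.leadingCoeff, h2, h1] at h3
    exact h3.symm
  have hG0 : G = 0 := by
    rw [← Polynomial.leadingCoeff_eq_zero]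
    by_contra h0
    exact hξ1 (mul_right_cancel₀ h0 (by rw [one_mul]; exact hlc.symm))
  have h0 : (0 : ℕ) ∈ blocks ν (w + 1) k := by
    simp only [blocks, Finset.mem_image, Finset.mem_product, Finset.mem_range, Prod.exists]
    exact ⟨0, 0, ⟨by omega, hk⟩, by simp⟩
  have := hGeval 0 h0
  simp [hG0, hg] at this

theorem factorial_card_le_prod {ι : Type*} [DecidableEq ι] (s : Finset ι) (f : ι → ℕ)
    (hf : ∀ i ∈ s, 0 < f i) (hinj : Set.InjOn f s) : s.card.factorial ≤ ∏ i ∈ s, f i := by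
  induction hn : s.card generalizing s with
  | zero =>
    rw [Finset.card_eq_zero] at hn
    simp [hn]
  | succ n ih =>
    have hne : s.Nonempty := Finset.card_pos.mp (by omega)
    obtain ⟨i, hi, hmax⟩ := Finset.exists_max_image s f hne
    have hc : (s.erase i).card = n := by rw [Finset.card_erase_of_mem hi, hn]; rfl
    have h1 := ih (s.erase i) (fun j hj => hf j (Finset.mem_of_mem_erase hj))
      (hinj.mono (by simp)) hc
    have h2 : n + 1 ≤ f i := by
      rw [← hn, ← Finset.card_image_of_injOn hinj]
      calc _ ≤ (Finset.Icc 1 (f i)).card := Finset.card_le_card fun x hx => by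
            obtain ⟨j, hj, rfl⟩ := Finset.mem_image.mp hx
            exact Finset.mem_Icc.mpr ⟨hf j hj, hmax j hj⟩
        _ = f i := by simp
    rw [← Finset.mul_prod_erase s f hi, Nat.factorial_succ]
    exact Nat.mul_le_mul h2 h1

/-- The distances from `e` to the nodes on one side are distinct positive integers, so the product
is at least `A! B!` with `A + B = n`, and `n! / (A! B!) ≤ 2 ^ n`. -/
theorem abs_dividedCoeff_le {E : Finset ℕ} {e n : ℕ} (he : e ∈ E) (hn : E.card = n + 1) :
    |dividedCoeff E e| ≤ 2 ^ n / n.factorial := by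
  set A := (E.erase e).filter (· < e) with hA
  set B := (E.erase e).filter (fun x => ¬ x < e) with hB
  have hAB : A.card + B.card = n := by
    rw [hA, hB, Finset.card_filter_add_card_filter_not, Finset.card_erase_of_mem he, hn]; rfl
  have h1 : A.card.factorial ≤ ∏ x ∈ A, (e - x) := by
    refine factorial_card_le_prod A _ (fun x hx => ?_) (fun x hx y hy hxy => ?_)
    · simp [hA] at hx; omega
    · simp [hA] at hx hy hxy; omega
  have h2 : B.card.factorial ≤ ∏ x ∈ B, (x - e) := by
    refine factorial_card_le_prod B _ (fun x hx => ?_) (fun x hx y hy hxy => ?_)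
    · simp [hB] at hx; omega
    · simp [hB] at hx hy hxy; omega
  have h3 : |∏ x ∈ E.erase e, ((e : ℚ) - x)| =
      ((∏ x ∈ A, (e - x) : ℕ) : ℚ) * ((∏ x ∈ B, (x - e) : ℕ) : ℚ) := by
    rw [Finset.abs_prod, ← Finset.prod_filter_mul_prod_filter_not _ (· < e)]
    push_cast
    congr 1
    · refine Finset.prod_congr rfl fun x hx => ?_
      have : x < e := (Finset.mem_filter.mp hx).2
      rw [Nat.cast_sub this.le, abs_of_nonneg (sub_nonneg.mpr (by exact_mod_cast this.le))]
    · refine Finset.prod_congr rfl fun x hx => ?_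
      have : e ≤ x := not_lt.mp (Finset.mem_filter.mp hx).2
      rw [Nat.cast_sub this, abs_sub_comm,
        abs_of_nonneg (sub_nonneg.mpr (by exact_mod_cast this))]
  have h4 : n.factorial ≤ 2 ^ n * ((∏ x ∈ A, (e - x)) * ∏ x ∈ B, (x - e)) := by
    calc n.factorial = (A.card + B.card).choose A.card * A.card.factorial * B.card.factorial := by
          rw [Nat.choose_symm_add, Nat.add_choose_mul_factorial_mul_factorial, hAB]
      _ ≤ 2 ^ n * (∏ x ∈ A, (e - x)) * ∏ x ∈ B, (x - e) := by
          gcongr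
          rw [hAB]; exact Nat.choose_le_two_pow _ _
      _ = _ := by ring
  rw [dividedCoeff, abs_inv, h3, inv_eq_one_div, ← Nat.cast_mul]
  have hpos : 0 < (∏ x ∈ A, (e - x)) * ∏ x ∈ B, (x - e) := by
    have := Nat.factorial_pos n
    by_contra h0
    rw [Nat.eq_zero_of_not_pos h0] at h4
    omega
  rw [div_le_div_iff₀ (by exact_mod_cast hpos) (by exact_mod_cast Nat.factorial_pos n), one_mul]
  exact_mod_cast h4

/-- Expand `ξ ^ e = (1 + (ξ - 1)) ^ e` binomially: the terms with `m < n` are polynomials in `e` of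
degree below `n`, which the divided difference kills, and the rest carry a factor `(1 - ξ) ^ n`. -/
theorem abs_sum_pow_mul_dividedCoeff_le {E : Finset ℕ} {n W : ℕ} (hn : E.card = n + 1)
    (hW : ∀ e ∈ E, e ≤ W) {ξ : ℚ} (h0 : 0 ≤ ξ) (h1 : ξ ≤ 1) {B : ℚ}
    (hB : ∀ e ∈ E, |dividedCoeff E e| ≤ B) :
    |∑ e ∈ E, ξ ^ e * dividedCoeff E e| ≤ (n + 1) * B * 2 ^ W * (1 - ξ) ^ n := by
  set P : ℚ[X] := ∑ m ∈ Finset.range n, C ((ξ - 1) ^ m / m.factorial) * descPochhammer ℚ m with hP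
  have hPdeg : P.degree < (n : ℕ) := by
    rw [hP, ← Polynomial.mem_degreeLT]
    refine Submodule.sum_mem _ fun m hm => ?_
    rw [Polynomial.mem_degreeLT]
    rw [← Polynomial.smul_eq_C_mul]
    refine (Polynomial.degree_smul_le _ _).trans_lt ?_
    refine (Polynomial.degree_le_natDegree).trans_lt ?_
    rw [descPochhammer_natDegree]
    exact_mod_cast Finset.mem_range.mp hm
  have hPe : ∀ e : ℕ, P.eval (e : ℚ) = ∑ m ∈ Finset.range n, (e.choose m : ℚ) * (ξ - 1) ^ m := by
    intro e
    rw [hP, Polynomial.eval_finsetSum]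
    refine Finset.sum_congr rfl fun m _ => ?_
    rw [eval_mul, eval_C, descPochhammer_eval_eq_descFactorial,
      Nat.descFactorial_eq_factorial_mul_choose]
    have : (m.factorial : ℚ) ≠ 0 := by exact_mod_cast Nat.factorial_ne_zero m
    push_cast
    field_simp
  have hrem : ∀ e ∈ E, |ξ ^ e - P.eval (e : ℚ)| ≤ 2 ^ W * (1 - ξ) ^ n := by
    intro e he
    have hx : ξ ^ e = ∑ m ∈ Finset.range (e + 1), (e.choose m : ℚ) * (ξ - 1) ^ m := by
      conv_lhs => rw [show ξ = (ξ - 1) + 1 by ring, add_pow]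
      exact Finset.sum_congr rfl fun m _ => by rw [one_pow]; ring
    have hx' : ξ ^ e = ∑ m ∈ Finset.range (n + (e + 1)), (e.choose m : ℚ) * (ξ - 1) ^ m := by
      rw [hx]
      refine Finset.sum_subset (Finset.range_subset_range.mpr (by omega)) fun m _ hm => ?_
      rw [Nat.choose_eq_zero_of_lt (by simpa using hm)]; simp
    rw [hx', Finset.sum_range_add, hPe, add_sub_cancel_left]
    calc _ ≤ ∑ m ∈ Finset.range (e + 1), |(e.choose (n + m) : ℚ) * (ξ - 1) ^ (n + m)| :=
          Finset.abs_sum_le_sum_abs _ _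
      _ ≤ ∑ m ∈ Finset.range (e + 1), (e.choose (n + m) : ℚ) * (1 - ξ) ^ n := by
          refine Finset.sum_le_sum fun m _ => ?_
          rw [abs_mul, abs_pow, abs_sub_comm, abs_of_nonneg (sub_nonneg.mpr h1), Nat.abs_cast,
            pow_add]
          have : (1 - ξ) ^ m ≤ 1 := pow_le_one₀ (by linarith) (by linarith)
          have h2 : 0 ≤ (1 - ξ) ^ n := pow_nonneg (by linarith) _
          gcongr
          nlinarith
      _ = ((∑ m ∈ Finset.range (e + 1), e.choose (n + m) : ℕ) : ℚ) * (1 - ξ) ^ n := by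
          push_cast; rw [Finset.sum_mul]
      _ ≤ 2 ^ W * (1 - ξ) ^ n := by
          have h2 : 0 ≤ (1 - ξ) ^ n := pow_nonneg (by linarith) _
          gcongr
          have : ∑ m ∈ Finset.range (e + 1), e.choose (n + m) ≤ 2 ^ W := by
            calc _ ≤ ∑ m ∈ Finset.range (n + (e + 1)), e.choose m := by
                  rw [Finset.sum_range_add _ n]; exact Nat.le_add_left _ _
              _ = ∑ m ∈ Finset.range (e + 1), e.choose m := by
                  refine (Finset.sum_subset (Finset.range_subset_range.mpr (by omega))
                    fun m _ hm => ?_).symm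
                  exact Nat.choose_eq_zero_of_lt (by simpa using hm)
              _ = 2 ^ e := Nat.sum_range_choose e
              _ ≤ 2 ^ W := Nat.pow_le_pow_right (by norm_num) (hW e he)
          exact_mod_cast this
  have hzero : ∑ e ∈ E, P.eval (e : ℚ) * dividedCoeff E e = 0 := by
    rw [sum_eval_mul_dividedCoeff (hPdeg.trans_le (by rw [hn]; exact_mod_cast Nat.le_succ n)), hn]
    exact Polynomial.coeff_eq_zero_of_degree_lt hPdeg
  have hsub : ∑ e ∈ E, ξ ^ e * dividedCoeff E e =
      ∑ e ∈ E, (ξ ^ e - P.eval (e : ℚ)) * dividedCoeff E e := by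
    simp only [sub_mul, Finset.sum_sub_distrib, hzero, sub_zero]
  rw [hsub]
  calc _ ≤ ∑ e ∈ E, |(ξ ^ e - P.eval (e : ℚ)) * dividedCoeff E e| :=
        Finset.abs_sum_le_sum_abs _ _
    _ ≤ ∑ e ∈ E, 2 ^ W * (1 - ξ) ^ n * B := by
        refine Finset.sum_le_sum fun e he => ?_
        rw [abs_mul]
        exact mul_le_mul (hrem e he) (hB e he) (abs_nonneg _)
          (mul_nonneg (by positivity) (pow_nonneg (by linarith) _))
    _ = _ := by rw [Finset.sum_const, hn, nsmul_eq_mul]; push_cast; ring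

/-! ### Denominators and sizes of the coefficients -/

theorem prod_range_abs_sub_eq_descFactorial {n M : ℕ} {u : ℕ → ℤ}
    (hM : n ≤ M + 1) (h : ∀ i < n, |u i| = (M : ℤ) - i) :
    |∏ i ∈ Finset.range n, u i| = (M.descFactorial n : ℤ) := by
  rw [Finset.abs_prod, Nat.descFactorial_eq_prod_range, Nat.cast_prod]
  refine Finset.prod_congr rfl fun i hi => ?_
  have hi := Finset.mem_range.mp hi
  rw [h i hi, Nat.cast_sub (by omega)]

theorem prod_range_abs_add_eq_descFactorial {n a : ℕ} {u : ℕ → ℤ}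
    (h : ∀ i < n, |u i| = (a : ℤ) + 1 + i) :
    |∏ i ∈ Finset.range n, u i| = ((a + n).descFactorial n : ℤ) := by
  rw [← Finset.prod_range_reflect]
  refine prod_range_abs_sub_eq_descFactorial (by omega) fun i hi => ?_
  rw [h _ (by omega)]
  push_cast [show 1 ≤ n by omega, show i ≤ n - 1 by omega]
  ring

theorem descFactorial_dvd_factorial_mul_lcmUpto {M n N : ℕ} (h : n ≤ M) (hN : M ≤ N) :
    M.descFactorial n ∣ n.factorial * Nat.lcmUpto N := by
  rw [Nat.descFactorial_eq_factorial_mul_choose]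
  refine Nat.mul_dvd_mul_left _ ((Chebyshev.choose_dvd_lcmUpto h).trans ?_)
  exact Finset.lcm_mono (Finset.Icc_subset_Icc_right hN)

/-- For a block other than that of the node, the differences are `w + 1` consecutive integers up to
sign, so their product is `(w + 1)!` times a binomial coefficient, which divides the lcm. For the
node's own block the product is `i₀! (w - i₀)!` up to sign. -/
theorem block_prod_dvd {ν w k i₀ j₀ j : ℕ} (hw : w < ν) (hi₀ : i₀ ≤ w) (hj₀ : j₀ < k)
    (hj : j < k) :
    (∏ i ∈ Finset.range (w + 1), if i + ν * j = i₀ + ν * j₀ then (1 : ℤ)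
      else ((i₀ + ν * j₀ : ℕ) : ℤ) - ((i + ν * j : ℕ) : ℤ)) ∣
      (((w + 1).factorial * Nat.lcmUpto (k * ν) : ℕ) : ℤ) := by
  rw [← abs_dvd]
  have hk : ∀ j < k, ν * j + ν ≤ k * ν := fun j hj => by
    have := Nat.mul_le_mul_left ν (show j + 1 ≤ k from hj); nlinarith
  rcases lt_trichotomy j j₀ with hlt | rfl | hlt
  · have h1 : ν * j + ν ≤ ν * j₀ := by
      have := Nat.mul_le_mul_left ν (show j + 1 ≤ j₀ from hlt); nlinarith
    obtain ⟨d, hd⟩ := Nat.exists_eq_add_of_le h1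
    rw [prod_range_abs_sub_eq_descFactorial (M := i₀ + ν + d) (by omega)]
    · exact_mod_cast descFactorial_dvd_factorial_mul_lcmUpto (by omega)
        (by have := hk j₀ hj₀; omega)
    · intro i hi
      rw [if_neg (by omega), hd]
      push_cast
      rw [abs_of_nonneg (by omega)]; ring
  · obtain ⟨r, rfl⟩ := Nat.exists_eq_add_of_le hi₀
    rw [show i₀ + r + 1 = i₀ + (1 + r) by ring, Finset.prod_range_add, Finset.prod_range_add]
    simp only [Finset.prod_range_one, add_zero, if_true, one_mul]
    rw [abs_mul, prod_range_abs_sub_eq_descFactorial (M := i₀) (by omega),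
      prod_range_abs_add_eq_descFactorial (a := 0), zero_add, Nat.descFactorial_self,
      Nat.descFactorial_self]
    · have h1 := Nat.factorial_mul_factorial_dvd_factorial_add i₀ r
      have h2 := Nat.factorial_dvd_factorial (show i₀ + r ≤ i₀ + (1 + r) by omega)
      exact_mod_cast (h1.trans h2).trans (Dvd.intro _ rfl)
    · intro i hi
      rw [if_neg (by omega), abs_of_nonpos (by push_cast; omega)]
      push_cast; ring
    · intro i hi
      rw [if_neg (by omega), abs_of_nonneg (by push_cast; omega)]
      push_cast; ring
  · have h1 : ν * j₀ + ν ≤ ν * j := by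
      have := Nat.mul_le_mul_left ν (show j₀ + 1 ≤ j from hlt); nlinarith
    obtain ⟨d, hd⟩ := Nat.exists_eq_add_of_le h1
    obtain ⟨r, hr⟩ := Nat.exists_eq_add_of_lt (show i₀ < ν by omega)
    rw [prod_range_abs_add_eq_descFactorial (a := r + d)]
    · exact_mod_cast descFactorial_dvd_factorial_mul_lcmUpto (by omega)
        (by have := hk j hj; omega)
    · intro i hi
      rw [if_neg (by omega), abs_of_nonpos (by rw [hd]; push_cast; omega), hd]
      have : (ν : ℤ) = i₀ + r + 1 := by exact_mod_cast hr
      push_cast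
      linarith

/-- A common denominator for the coefficients of divided differences over the blocks. -/
noncomputable def blockDenom (ν w k : ℕ) : ℕ := ((w + 1).factorial * Nat.lcmUpto (k * ν)) ^ k

theorem exists_int_eq_blockDenom_mul {E : Finset ℕ} {ν w k e : ℕ} (hw : w < ν)
    (hE : E ⊆ blocks ν (w + 1) k) (he : e ∈ E) :
    ∃ z : ℤ, (blockDenom ν w k : ℚ) * dividedCoeff E e = z := by
  have hdvd : (∏ e' ∈ E.erase e, ((e : ℤ) - e')) ∣ (blockDenom ν w k : ℤ) := by
    have h1 : (∏ e' ∈ E.erase e, ((e : ℤ) - e')) =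
        ∏ e' ∈ E, if e' = e then 1 else ((e : ℤ) - e') := by
      rw [← Finset.mul_prod_erase E _ he, if_pos rfl, one_mul]
      exact Finset.prod_congr rfl fun x hx => by rw [if_neg (Finset.ne_of_mem_erase hx)]
    rw [h1]
    refine (Finset.prod_dvd_prod_of_subset _ _ _ hE).trans ?_
    have he' := hE he
    simp only [blocks, Finset.mem_image, Finset.mem_product, Finset.mem_range, Prod.exists] at he'
    obtain ⟨i₀, j₀, ⟨hi₀, hj₀⟩, rfl⟩ := he'
    rw [blocks, Finset.prod_image (blocks_injOn hw), Finset.prod_product_right, blockDenom,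
      Nat.cast_pow]
    calc _ ∣ ∏ j ∈ Finset.range k, (((w + 1).factorial * Nat.lcmUpto (k * ν) : ℕ) : ℤ) :=
          Finset.prod_dvd_prod_of_dvd _ _ fun j hj =>
            block_prod_dvd hw (by omega) hj₀ (Finset.mem_range.mp hj)
      _ = _ := by simp
  obtain ⟨z, hz⟩ := hdvd
  refine ⟨z, ?_⟩
  have hne : (∏ e' ∈ E.erase e, ((e : ℚ) - e')) ≠ 0 := by
    rw [Finset.prod_ne_zero_iff]
    intro x hx
    rw [sub_ne_zero]
    exact_mod_cast (Finset.ne_of_mem_erase hx).symm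
  have hz' : (blockDenom ν w k : ℚ) = (∏ e' ∈ E.erase e, ((e : ℚ) - e')) * z := by
    exact_mod_cast congrArg (Int.cast : ℤ → ℚ) hz
  rw [hz', dividedCoeff]
  field_simp

theorem lcmUpto_le_two_pow (n : ℕ) : Nat.lcmUpto n ≤ 2 ^ (8 * n) := by
  have h1 := Chebyshev.psi_le_const_mul_self (x := (n : ℝ)) (by positivity)
  rw [Chebyshev.psi_eq_log_lcmUpto] at h1
  have h2 : Real.log 4 = 2 * Real.log 2 := by
    rw [show (4 : ℝ) = 2 ^ 2 by norm_num, Real.log_pow]; norm_num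
  have h3 := Real.log_two_gt_d9
  have h4 : Real.log (Nat.lcmUpto n) ≤ Real.log ((2 : ℝ) ^ (8 * n)) := by
    rw [Real.log_pow]
    refine h1.trans ?_
    push_cast
    have hn : (0 : ℝ) ≤ n := by positivity
    nlinarith
  have h5 : (Nat.lcmUpto n : ℝ) ≤ (2 : ℝ) ^ (8 * n) :=
    (Real.log_le_log_iff (by exact_mod_cast Nat.lcmUpto_pos n) (by positivity)).mp h4
  exact_mod_cast h5

/-- This lets the `(k * w)!` in the bound for the coefficients absorb the factorials in the common
denominator, leaving only an exponential factor. -/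
theorem factorial_pow_le_factorial_mul (w k : ℕ) : w.factorial ^ k ≤ (k * w).factorial := by
  induction k with
  | zero => simp
  | succ k ih =>
    rw [pow_succ, Nat.succ_mul]
    exact (Nat.mul_le_mul_right _ ih).trans
      (Nat.le_of_dvd (Nat.factorial_pos _) (Nat.factorial_mul_factorial_dvd_factorial_add _ _))

/-- Bound for the coefficients after clearing denominators. -/
theorem blockDenom_mul_le {ν w k : ℕ} (hw : w < ν) (hk : 0 < k) :
    (blockDenom ν w k : ℚ) * (2 ^ (k * w) / (k * w).factorial) ≤ 2 ^ (10 * k ^ 2 * ν) := by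
  have h1 : blockDenom ν w k * 2 ^ (k * w) ≤ 2 ^ (10 * k ^ 2 * ν) * (k * w).factorial := by
    have h2 : w + 1 ≤ 2 ^ w := Nat.lt_two_pow_self
    calc blockDenom ν w k * 2 ^ (k * w)
        = (w + 1) ^ k * w.factorial ^ k * Nat.lcmUpto (k * ν) ^ k * 2 ^ (k * w) := by
          rw [blockDenom, Nat.factorial_succ, mul_pow, mul_pow]
      _ ≤ (2 ^ w) ^ k * (k * w).factorial * (2 ^ (8 * (k * ν))) ^ k * 2 ^ (k * w) := by
          gcongr
          · exact factorial_pow_le_factorial_mul w k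
          · exact lcmUpto_le_two_pow _
      _ = 2 ^ (2 * (k * w) + 8 * k ^ 2 * ν) * (k * w).factorial := by
          rw [← pow_mul, ← pow_mul, pow_add]
          ring
      _ ≤ _ := by
          gcongr
          · norm_num
          · nlinarith [Nat.mul_le_mul (Nat.mul_le_mul_left k hk) hw.le, Nat.zero_le (k * w)]
  rw [← mul_div_assoc, div_le_iff₀ (by exact_mod_cast Nat.factorial_pos _)]
  exact_mod_cast h1

theorem mod_le_and_div_lt_of_mem_blocks {ν w k e : ℕ} (hw : w < ν)
    (he : e ∈ blocks ν (w + 1) k) : e % ν ≤ w ∧ e / ν < k := by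
  simp only [blocks, Finset.mem_image, Finset.mem_product, Finset.mem_range, Prod.exists] at he
  obtain ⟨i, j, ⟨hi, hj⟩, rfl⟩ := he
  rw [Nat.add_mul_mod_self_left, Nat.mod_eq_of_lt (by omega),
    Nat.add_mul_div_left _ _ (by omega : 0 < ν), Nat.div_eq_of_lt (by omega)]
  omega

/-! ### The approximation inequality -/

/-- A rational number `η` of small denominator cannot be too close to a high power of a rational
number `ξ` that is itself close to `1`. -/
theorem one_le_of_approx {ξ η : ℚ} {ν w k x N q u : ℕ} {δ₁ δ₂ : ℚ} (hw : w < ν) (hk : 0 < k)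
    (hN : 0 < N) (hξN : ξ * N = x) (hq : 0 < q) (hηq : η * q = u) (hξ0 : 0 ≤ ξ) (hξ1 : ξ < 1)
    (hδ₁ : 1 - ξ ≤ δ₁) (hδ₂ : ∀ j < k, |η ^ j - (ξ ^ ν) ^ j| ≤ δ₂) :
    1 ≤ 2 ^ (12 * k ^ 2 * ν) * (δ₁ ^ (k * w) + δ₂) * (N : ℚ) ^ w * (q : ℚ) ^ k := by
  obtain ⟨E, hE, hEc, hS⟩ := exists_dividedDifference_ne_zero (ξ := ξ) (η := η) hξ1.ne hw hk
  set S := ∑ e ∈ E, ξ ^ (e % ν) * η ^ (e / ν) * dividedCoeff E e with hSdef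
  set K := blockDenom ν w k with hK
  set B : ℚ := 2 ^ (k * w) / (k * w).factorial with hB
  have hB0 : 0 ≤ B := by positivity
  have hKpos : 0 < K := by
    rw [hK, blockDenom]
    exact pow_pos (Nat.mul_pos (Nat.factorial_pos _) (Nat.lcmUpto_pos _)) _
  have hδ₂0 : 0 ≤ δ₂ := (abs_nonneg _).trans (hδ₂ 0 hk)
  have hδ₁0 : 0 ≤ δ₁ := by linarith
  have hBe : ∀ e ∈ E, |dividedCoeff E e| ≤ B := fun e he => abs_dividedCoeff_le he hEc
  -- the lower bound
  have hint : ∃ z : ℤ, (K : ℚ) * S * (N : ℚ) ^ w * (q : ℚ) ^ k = z := by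
    have hterm : ∀ e ∈ E, ∃ z : ℤ, (K : ℚ) * (ξ ^ (e % ν) * η ^ (e / ν) * dividedCoeff E e) *
        (N : ℚ) ^ w * (q : ℚ) ^ k = z := by
      intro e he
      obtain ⟨z, hz⟩ := exists_int_eq_blockDenom_mul hw hE he
      obtain ⟨h1, h2⟩ := mod_le_and_div_lt_of_mem_blocks hw (hE he)
      refine ⟨z * (x ^ (e % ν) * N ^ (w - e % ν)) * (u ^ (e / ν) * q ^ (k - e / ν)), ?_⟩
      push_cast
      rw [← hz, ← hξN, ← hηq]
      have hNw : (N : ℚ) ^ w = N ^ (e % ν) * N ^ (w - e % ν) := by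
        rw [← pow_add, Nat.add_sub_of_le h1]
      have hqk : (q : ℚ) ^ k = q ^ (e / ν) * q ^ (k - e / ν) := by
        rw [← pow_add, Nat.add_sub_of_le h2.le]
      rw [hNw, hqk]
      rw [mul_pow, mul_pow]
      ring
    choose! z hz using hterm
    refine ⟨∑ e ∈ E, z e, ?_⟩
    push_cast
    rw [← Finset.sum_congr rfl hz, hSdef, Finset.mul_sum, Finset.sum_mul, Finset.sum_mul]
  have hlow : 1 ≤ (K : ℚ) * |S| * (N : ℚ) ^ w * (q : ℚ) ^ k := by
    obtain ⟨z, hz⟩ := hint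
    have hz0 : z ≠ 0 := by
      rintro rfl
      have : (K : ℚ) * S * (N : ℚ) ^ w * (q : ℚ) ^ k ≠ 0 := by positivity
      exact this (by rw [hz]; simp)
    have h1 : (1 : ℚ) ≤ |(z : ℚ)| := by exact_mod_cast Int.one_le_abs hz0
    rw [← hz, abs_mul, abs_mul, abs_mul] at h1
    simpa using h1
  -- the upper bound
  have hup : |S| ≤ (k * w + 1) * B * 2 ^ (k * ν) * (δ₁ ^ (k * w) + δ₂) := by
    -- Replacing `η` by `ξ ^ ν` turns the function into `e ↦ ξ ^ e`; the second sum is the error of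
    -- that replacement.
    have hsplit : S = ∑ e ∈ E, ξ ^ e * dividedCoeff E e +
        ∑ e ∈ E, (ξ ^ (e % ν) * (η ^ (e / ν) - (ξ ^ ν) ^ (e / ν))) * dividedCoeff E e := by
      rw [hSdef, ← Finset.sum_add_distrib]
      refine Finset.sum_congr rfl fun e _ => ?_
      have h1 : ξ ^ e = ξ ^ (e % ν) * (ξ ^ ν) ^ (e / ν) := by
        rw [← pow_mul, ← pow_add, Nat.mod_add_div]
      rw [h1]; ring
    have h1 := abs_sum_pow_mul_dividedCoeff_le (n := k * w) (W := k * ν) hEc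
      (fun e he => (lt_of_mem_blocks hw (hE he)).le) hξ0 hξ1.le hBe
    have h2 : |∑ e ∈ E, (ξ ^ (e % ν) * (η ^ (e / ν) - (ξ ^ ν) ^ (e / ν))) * dividedCoeff E e| ≤
        (k * w + 1) * (δ₂ * B) := by
      calc _ ≤ ∑ e ∈ E, |(ξ ^ (e % ν) * (η ^ (e / ν) - (ξ ^ ν) ^ (e / ν))) * dividedCoeff E e| :=
            Finset.abs_sum_le_sum_abs _ _
        _ ≤ ∑ e ∈ E, δ₂ * B := by
            refine Finset.sum_le_sum fun e he => ?_
            rw [abs_mul, abs_mul, abs_of_nonneg (pow_nonneg hξ0 _)]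
            refine mul_le_mul ?_ (hBe e he) (abs_nonneg _) hδ₂0
            have h3 := hδ₂ _ (mod_le_and_div_lt_of_mem_blocks hw (hE he)).2
            calc _ ≤ 1 * |η ^ (e / ν) - (ξ ^ ν) ^ (e / ν)| := by
                  gcongr; exact pow_le_one₀ hξ0 hξ1.le
              _ ≤ δ₂ := by rw [one_mul]; exact h3
        _ = _ := by rw [Finset.sum_const, hEc, nsmul_eq_mul]; push_cast; ring
    have h3 : (1 - ξ) ^ (k * w) ≤ δ₁ ^ (k * w) := pow_le_pow_left₀ (by linarith) hδ₁ _
    have h4 : (1 : ℚ) ≤ 2 ^ (k * ν) := one_le_pow₀ (by norm_num)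
    rw [hsplit]
    refine (abs_add_le _ _).trans ((add_le_add h1 h2).trans ?_)
    push_cast
    rw [mul_add]
    refine add_le_add ?_ ?_
    · gcongr
    · calc ((k : ℚ) * w + 1) * (δ₂ * B) = (k * w + 1) * B * 1 * δ₂ := by ring
        _ ≤ _ := by gcongr
  have hKB := blockDenom_mul_le hw hk
  have hn : ((k : ℚ) * w + 1) ≤ 2 ^ (k * ν) := by
    have h1 : k * w + 1 ≤ 2 ^ (k * w) := Nat.lt_two_pow_self
    have h2 : 2 ^ (k * w) ≤ 2 ^ (k * ν) := Nat.pow_le_pow_right (by norm_num) (by gcongr)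
    exact_mod_cast h1.trans h2
  calc 1 ≤ (K : ℚ) * |S| * (N : ℚ) ^ w * (q : ℚ) ^ k := hlow
    _ ≤ K * ((k * w + 1) * B * 2 ^ (k * ν) * (δ₁ ^ (k * w) + δ₂)) * N ^ w * q ^ k := by gcongr
    _ = (K * B) * (k * w + 1) * 2 ^ (k * ν) * (δ₁ ^ (k * w) + δ₂) * N ^ w * q ^ k := by ring
    _ ≤ 2 ^ (10 * k ^ 2 * ν) * 2 ^ (k * ν) * 2 ^ (k * ν) * (δ₁ ^ (k * w) + δ₂) * N ^ w * q ^ k := by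
        gcongr
    _ = 2 ^ (10 * k ^ 2 * ν + k * ν + k * ν) * (δ₁ ^ (k * w) + δ₂) * N ^ w * q ^ k := by
        rw [pow_add, pow_add]
    _ ≤ _ := by
        gcongr
        · norm_num
        · nlinarith [Nat.mul_le_mul_right (k * ν) (show 1 ≤ k from hk)]

/-! ### Finiteness of the near multiples -/

/-- The exponents `ℓ` for which `2 ^ ℓ` is very close to a small multiple of a power of `p`. -/
def nearMultiples (p m M : ℕ) : Set ℕ :=
  {ℓ | ∃ X a Y : ℕ, 2 ^ ℓ = X * p ^ a + Y ∧ 0 < Y ∧ Y * 2 ^ (ℓ / m) ≤ 2 ^ ℓ ∧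
    0 < X ∧ X ≤ 2 ^ (ℓ / M)}

/-- The inequalities between exponents in the proof of finiteness. -/
theorem exponent_bounds {m ℓ₁ ℓ₂ w : ℕ} (hm : 0 < m) (h1 : 12544 * m ^ 3 ≤ ℓ₁)
    (hw : 256 * m ^ 2 ≤ w) (hlow : 4 * m * ℓ₁ * w ≤ ℓ₂) (hup : ℓ₂ < 4 * m * ℓ₁ * (w + 1)) :
    12 * (4 * m) ^ 2 * (4 * m * w) + ℓ₁ * w + (4 * m) * (ℓ₂ / (256 * m ^ 2) +
      4 * m * w * (ℓ₁ / (256 * m ^ 2)) + 4 * m * ℓ₁ + 4 * m * w) + (4 * m + 3) ≤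
      2 * ℓ₁ * w ∧ 2 * ℓ₁ * w ≤ ℓ₁ / m * (4 * m * w) ∧ 2 * ℓ₁ * w ≤ ℓ₂ / m := by
  have hd₂ : ℓ₂ / (256 * m ^ 2) * (256 * m ^ 2) ≤ ℓ₂ := Nat.div_mul_le_self _ _
  have hd₁ : ℓ₁ / (256 * m ^ 2) * (256 * m ^ 2) ≤ ℓ₁ := Nat.div_mul_le_self _ _
  set d₂ := ℓ₂ / (256 * m ^ 2)
  set d₁ := ℓ₁ / (256 * m ^ 2)
  have hm2 : 0 < m ^ 2 := by positivity
  have hm3 : 0 < m ^ 3 := by positivity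
  have hmm3 : m ≤ m ^ 3 := Nat.le_self_pow (by norm_num) m
  have hm23 : m ^ 2 ≤ m ^ 3 := Nat.pow_le_pow_right hm (by norm_num)
  have hw1 : 1 ≤ w := by omega
  -- Besides the main term `ℓ₁ * w`, the left side consists of five error groups, each at most an
  -- eighth of `ℓ₁ * w`.
  have hA : 32 * (m * d₂) ≤ ℓ₁ * w := by
    refine Nat.le_of_mul_le_mul_left (c := 8 * m) ?_ (by omega)
    calc 8 * m * (32 * (m * d₂)) = d₂ * (256 * m ^ 2) := by ring
      _ ≤ 4 * m * ℓ₁ * (w + 1) := hd₂.trans hup.le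
      _ ≤ 4 * m * ℓ₁ * (w + w) := by gcongr
      _ = 8 * m * (ℓ₁ * w) := by ring
  have hB : 16 * (4 * m * (4 * m * w * d₁)) ≤ ℓ₁ * w := by
    calc _ = d₁ * (256 * m ^ 2) * w := by ring
      _ ≤ _ := by gcongr
  have hC : 16 * (4 * m * (4 * m * ℓ₁)) ≤ ℓ₁ * w := by
    calc _ = ℓ₁ * (256 * m ^ 2) := by ring
      _ ≤ _ := by gcongr
  have hD : 16 * (12 * (4 * m) ^ 2 * (4 * m * w) + 4 * m * (4 * m * w)) ≤ ℓ₁ * w := by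
    calc _ = (12288 * m ^ 3 + 256 * m ^ 2) * w := by ring
      _ ≤ ℓ₁ * w := by gcongr; omega
  have hE : 16 * (4 * m + 3) ≤ ℓ₁ * w := by
    calc 16 * (4 * m + 3) ≤ ℓ₁ * 1 := by omega
      _ ≤ _ := by gcongr
  refine ⟨by linarith, ?_, ?_⟩
  · have h2 : ℓ₁ < m * (ℓ₁ / m + 1) := Nat.lt_mul_div_succ _ hm
    have h3 : 1 ≤ ℓ₁ / m := (Nat.one_le_div_iff hm).mpr (by omega)
    have h4 : ℓ₁ ≤ 2 * (m * (ℓ₁ / m)) := by nlinarith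
    calc 2 * ℓ₁ * w ≤ 2 * (2 * (m * (ℓ₁ / m))) * w := by gcongr
      _ = _ := by ring
  · rw [Nat.le_div_iff_mul_le hm]
    refine le_trans ?_ hlow
    nlinarith [Nat.zero_le (m * ℓ₁ * w)]

theorem one_add_pow_sub_one_le {t : ℚ} (h0 : 0 ≤ t) (h1 : t ≤ 1) (j : ℕ) :
    (1 + t) ^ j - 1 ≤ 2 ^ j * t := by
  -- The induction needs this sharper constant.
  have h : (1 + t) ^ j - 1 ≤ (2 ^ j - 1) * t := by
    induction j with
    | zero => simp
    | succ j ih =>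
      have h2 : (0 : ℚ) ≤ 2 ^ j - 1 := sub_nonneg.mpr (one_le_pow₀ (by norm_num))
      have h3 : (1 + t) * ((1 + t) ^ j - 1) ≤ 2 * ((2 ^ j - 1) * t) :=
        mul_le_mul (by linarith) ih (sub_nonneg.mpr (one_le_pow₀ (by linarith))) (by norm_num)
      rw [pow_succ, pow_succ]
      linarith
  linarith

/-- In `ξ ^ ν / ζ` the powers of 2 cancel down to `2 ^ ρ` in the numerator. A power `p ^ d` survives
on one side; if it is in the denominator, its size is bounded because `ξ ≥ 1/2` and `ζ ≤ 1`. -/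
theorem den_bound {p ν ℓ₁ ℓ₂ X₁ X₂ a₁ a₂ s₁ s₂ ρ : ℕ} (hp : 0 < p) (hρ : ℓ₂ = ν * ℓ₁ + ρ)
    (hX₁ : X₁ ≤ 2 ^ s₁) (hX₂ : X₂ ≤ 2 ^ s₂) (hX₂0 : 0 < X₂)
    (h₁ : 2 ^ ℓ₁ ≤ 2 * (X₁ * p ^ a₁)) (h₁' : 0 < X₁) (h₂ : X₂ * p ^ a₂ ≤ 2 ^ ℓ₂) :
    ∃ q u : ℕ, 0 < q ∧ q ≤ 2 ^ (s₂ + ν * s₁ + ρ + ν) ∧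
      ((X₁ * p ^ a₁ : ℚ) / 2 ^ ℓ₁) ^ ν / ((X₂ * p ^ a₂ : ℚ) / 2 ^ ℓ₂) * q = u := by
  have hpQ : (p : ℚ) ≠ 0 := by exact_mod_cast hp.ne'
  have hXQ : (X₂ : ℚ) ≠ 0 := by exact_mod_cast hX₂0.ne'
  rcases le_total a₂ (ν * a₁) with h | h
  · obtain ⟨d, hd⟩ := Nat.exists_eq_add_of_le h
    refine ⟨X₂, X₁ ^ ν * p ^ d * 2 ^ ρ, hX₂0,
      hX₂.trans (Nat.pow_le_pow_right (by norm_num) (by omega)), ?_⟩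
    push_cast
    have e1 : ((p : ℚ) ^ a₁) ^ ν = p ^ a₂ * p ^ d := by rw [← pow_mul, mul_comm, hd, pow_add]
    have e2 : (2 : ℚ) ^ ℓ₂ = (2 ^ ℓ₁) ^ ν * 2 ^ ρ := by rw [hρ, pow_add, ← pow_mul, mul_comm ν]
    rw [div_pow, mul_pow, e1, e2]
    field_simp
  · obtain ⟨d, hd⟩ := Nat.exists_eq_add_of_le h
    refine ⟨X₂ * p ^ d, X₁ ^ ν * 2 ^ ρ, by positivity, ?_, ?_⟩
    · have h3 : (2 ^ ℓ₁) ^ ν * (X₂ * p ^ d) ≤ (2 ^ ℓ₁) ^ ν * 2 ^ (s₂ + ν * s₁ + ρ + ν) := by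
        calc (2 ^ ℓ₁) ^ ν * (X₂ * p ^ d) ≤ (2 * (2 ^ s₁ * p ^ a₁)) ^ ν * (X₂ * p ^ d) := by
              gcongr; exact h₁.trans (by gcongr)
          _ = 2 ^ ν * (2 ^ s₁) ^ ν * (X₂ * p ^ a₂) := by
              rw [hd, pow_add, mul_pow, mul_pow, ← pow_mul p, mul_comm a₁]; ring
          _ ≤ 2 ^ ν * (2 ^ s₁) ^ ν * 2 ^ ℓ₂ := by gcongr
          _ = (2 ^ ℓ₁) ^ ν * 2 ^ (ν * s₁ + ρ + ν) := by
              rw [hρ, ← pow_mul, ← pow_mul, ← pow_add, ← pow_add, ← pow_add]; congr 1; ring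
          _ ≤ _ := by gcongr <;> omega
      exact Nat.le_of_mul_le_mul_left h3 (by positivity)
    · push_cast
      have e1 : (p : ℚ) ^ a₂ = ((p : ℚ) ^ a₁) ^ ν * p ^ d := by
        rw [← pow_mul, mul_comm a₁, hd, pow_add]
      have e2 : (2 : ℚ) ^ ℓ₂ = (2 ^ ℓ₁) ^ ν * 2 ^ ρ := by rw [hρ, pow_add, ← pow_mul, mul_comm ν]
      rw [div_pow, mul_pow, e1, e2]
      field_simp

/-- The summands 2 in the exponent hypotheses make each of the two terms at most 1/4. -/
theorem not_one_le_of_exponents {A e₁ n c e₂ l w q k s : ℕ}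
    (h : (1 : ℚ) ≤ 2 ^ A * (((2 : ℚ) ^ e₁)⁻¹ ^ n + 2 ^ c * ((2 : ℚ) ^ e₂)⁻¹) *
      ((2 ^ l : ℕ) : ℚ) ^ w * (q : ℚ) ^ k) (hq : q ≤ 2 ^ s)
    (h₁ : A + l * w + k * s + 2 ≤ e₁ * n) (h₂ : A + l * w + k * s + c + 2 ≤ e₂) : False := by
  set R := A + l * w + k * s with hR
  have hqQ : (q : ℚ) ^ k ≤ 2 ^ (k * s) := by
    have h1 : q ^ k ≤ (2 ^ s) ^ k := by gcongr
    rw [← pow_mul, mul_comm] at h1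
    exact_mod_cast h1
  have e1 : ((2 : ℚ) ^ e₁)⁻¹ ^ n ≤ (2 ^ (R + 2))⁻¹ := by
    rw [inv_pow, ← pow_mul]
    exact inv_anti₀ (by positivity) (pow_le_pow_right₀ (by norm_num) h₁)
  have e2 : 2 ^ c * ((2 : ℚ) ^ e₂)⁻¹ ≤ (2 ^ (R + 2))⁻¹ := by
    rw [← div_eq_mul_inv, div_le_iff₀ (by positivity), inv_mul_eq_div,
      le_div_iff₀ (by positivity), ← pow_add]
    exact pow_le_pow_right₀ (by norm_num) (by omega)
  have hRpos : (0 : ℚ) < 2 ^ R := by positivity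
  have hlast : (1 : ℚ) ≤ 2 ^ R * ((2 ^ (R + 2))⁻¹ + (2 ^ (R + 2))⁻¹) := by
    calc (1 : ℚ) ≤ _ := h
      _ ≤ 2 ^ A * ((2 ^ (R + 2))⁻¹ + (2 ^ (R + 2))⁻¹) *
          ((2 ^ l : ℕ) : ℚ) ^ w * 2 ^ (k * s) := by
          gcongr
      _ = 2 ^ A * 2 ^ (l * w) * 2 ^ (k * s) * ((2 ^ (R + 2))⁻¹ + (2 ^ (R + 2))⁻¹) := by
          push_cast
          rw [← pow_mul 2 l w]
          ring
      _ = _ := by rw [← pow_add, ← pow_add]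
  rw [pow_add _ R, mul_inv, mul_add, mul_inv_cancel_left₀ hRpos.ne'] at hlast
  norm_num at hlast

/-- Infinitely many exponents would supply a large `ℓ₁` and an `ℓ₂` enormous compared with it, which
contradicts `one_le_of_approx`. -/
theorem finite_nearMultiples {p m : ℕ} (hp : 0 < p) (hm : 0 < m) :
    (nearMultiples p m (256 * m ^ 2)).Finite := by
  by_contra hinf
  have hinf : (nearMultiples p m (256 * m ^ 2)).Infinite := hinf
  obtain ⟨ℓ₁, ⟨X₁, a₁, Y₁, hsum₁, hY₁, hYle₁, hX₁, hXle₁⟩, hℓ₁⟩ :=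
    hinf.exists_gt (12544 * m ^ 3)
  obtain ⟨ℓ₂, ⟨X₂, a₂, Y₂, hsum₂, hY₂, hYle₂, hX₂, hXle₂⟩, hℓ₂⟩ :=
    hinf.exists_gt (4 * m * ℓ₁ * (256 * m ^ 2))
  have hm3 : 0 < m ^ 3 := by positivity
  have hmm3 : m ≤ m ^ 3 := Nat.le_self_pow (by norm_num) m
  have hden : 0 < 4 * m * ℓ₁ := by
    have : 0 < ℓ₁ := by omega
    positivity
  -- With `k = 4 * m` and `ν = k * w`, the product `ν * ℓ₁` falls short of `ℓ₂` by less than `4 * m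
  -- * ℓ₁`. The gain `(1 - ξ) ^ (k * w)` is roughly `2 ^ (-4 ℓ₁ w)`, which beats `N ^ w = 2 ^ (ℓ₁
  -- w)`.
  set w := ℓ₂ / (4 * m * ℓ₁) with hwdef
  have hw : 256 * m ^ 2 ≤ w := by
    rw [hwdef, Nat.le_div_iff_mul_le hden]; linarith
  have hw0 : 0 < w := lt_of_lt_of_le (by positivity) hw
  have hlow : 4 * m * ℓ₁ * w ≤ ℓ₂ := Nat.mul_div_le _ _
  have hup : ℓ₂ < 4 * m * ℓ₁ * (w + 1) := Nat.lt_mul_div_succ _ hden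
  obtain ⟨hb1, hb2, hb3⟩ := exponent_bounds hm hℓ₁.le hw hlow hup
  set ν := 4 * m * w with hν
  obtain ⟨ρ, hρ⟩ := Nat.exists_eq_add_of_le (show ν * ℓ₁ ≤ ℓ₂ by rw [hν]; linarith)
  have hρ' : ρ ≤ 4 * m * ℓ₁ := by
    have : ν * ℓ₁ + ρ < ν * ℓ₁ + 4 * m * ℓ₁ := by
      rw [← hρ, hν]; linarith
    omega
  have he₁ : 1 ≤ ℓ₁ / m := (Nat.one_le_div_iff hm).mpr (by omega)
  have he₂ : 1 ≤ ℓ₂ / m := by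
    refine le_trans ?_ hb3
    have : 0 < ℓ₁ := by omega
    exact Nat.one_le_iff_ne_zero.mpr (by positivity)
  have half : ∀ {Y ℓ Z : ℕ}, 2 ^ ℓ = Z + Y → Y * 2 ^ (ℓ / m) ≤ 2 ^ ℓ → 1 ≤ ℓ / m →
      2 ^ ℓ ≤ 2 * Z := by
    intro Y ℓ Z h1 h2 h3
    have : Y * 2 ^ 1 ≤ Y * 2 ^ (ℓ / m) := by gcongr; norm_num
    omega
  have half₁ := half hsum₁ hYle₁ he₁
  have half₂ := half hsum₂ hYle₂ he₂
  obtain ⟨q, u, hq, hqle, hqu⟩ := den_bound (ν := ν) (a₂ := a₂) hp hρ hXle₁ hXle₂ hX₂ half₁ hX₁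
    (by omega)
  set ξ : ℚ := (X₁ * p ^ a₁ : ℚ) / 2 ^ ℓ₁ with hξ
  set ζ : ℚ := (X₂ * p ^ a₂ : ℚ) / 2 ^ ℓ₂ with hζ
  have key : ∀ {X a Y ℓ : ℕ}, 2 ^ ℓ = X * p ^ a + Y → 0 < Y → Y * 2 ^ (ℓ / m) ≤ 2 ^ ℓ →
      1 ≤ ℓ / m → ((X * p ^ a : ℚ) / 2 ^ ℓ) < 1 ∧ (1 / 2 : ℚ) ≤ (X * p ^ a : ℚ) / 2 ^ ℓ ∧
      1 - (X * p ^ a : ℚ) / 2 ^ ℓ ≤ ((2 : ℚ) ^ (ℓ / m))⁻¹ := by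
    intro X a Y ℓ h1 h2 h3 h4
    have h5 := half h1 h3 h4
    have h1Q : (2 : ℚ) ^ ℓ = X * p ^ a + Y := by exact_mod_cast h1
    have h2Q : (0 : ℚ) < Y := by exact_mod_cast h2
    have h3Q : (Y : ℚ) * 2 ^ (ℓ / m) ≤ 2 ^ ℓ := by exact_mod_cast h3
    have h5Q : (2 : ℚ) ^ ℓ ≤ 2 * (X * p ^ a) := by exact_mod_cast h5
    have hpos : (0 : ℚ) < 2 ^ ℓ := by positivity
    refine ⟨?_, ?_, ?_⟩
    · rw [div_lt_one hpos]; linarith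
    · rw [div_le_div_iff₀ (by norm_num) hpos]; linarith
    · have : 1 - (X * p ^ a : ℚ) / 2 ^ ℓ = Y / 2 ^ ℓ := by
        rw [eq_div_iff hpos.ne', sub_mul, div_mul_cancel₀ _ hpos.ne', h1Q]; ring
      rw [this, div_le_iff₀ hpos, inv_mul_eq_div, le_div_iff₀ (by positivity)]
      exact h3Q
  obtain ⟨hξ1, hξ2, hξ3⟩ := key hsum₁ hY₁ hYle₁ he₁
  obtain ⟨hζ1, hζ2, hζ3⟩ := key hsum₂ hY₂ hYle₂ he₂
  rw [← hξ] at hξ1 hξ2 hξ3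
  rw [← hζ] at hζ1 hζ2 hζ3
  have hξ0 : 0 < ξ := by linarith
  have hζ0 : 0 < ζ := by linarith
  -- Write `1 / ζ = 1 + t`; then `t` is at most twice `1 - ζ`, because `ζ ≥ 1/2`.
  have hδ₂ : ∀ j < 4 * m, |(ξ ^ ν / ζ) ^ j - (ξ ^ ν) ^ j| ≤
      2 ^ (4 * m + 1) * ((2 : ℚ) ^ (ℓ₂ / m))⁻¹ := by
    intro j hj
    set t := ζ⁻¹ - 1 with ht
    have hinv : ζ⁻¹ ≤ 2 := by rw [inv_le_comm₀ hζ0 (by norm_num)]; linarith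
    have ht0 : 0 ≤ t := sub_nonneg.mpr ((one_le_inv₀ hζ0).mpr hζ1.le)
    have ht1 : t ≤ 2 * ((2 : ℚ) ^ (ℓ₂ / m))⁻¹ := by
      have : t = ζ⁻¹ * (1 - ζ) := by rw [ht, mul_sub, inv_mul_cancel₀ hζ0.ne', mul_one]
      rw [this]
      exact mul_le_mul hinv hζ3 (by linarith) (by norm_num)
    have h1 : (ξ ^ ν / ζ) ^ j - (ξ ^ ν) ^ j = (ξ ^ ν) ^ j * ((1 + t) ^ j - 1) := by
      rw [ht, add_sub_cancel, div_eq_mul_inv, mul_pow]; ring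
    have h2 : (0 : ℚ) ≤ (1 + t) ^ j - 1 := sub_nonneg.mpr (one_le_pow₀ (by linarith))
    have h3 : (ξ ^ ν) ^ j ≤ 1 := pow_le_one₀ (by positivity) (pow_le_one₀ hξ0.le hξ1.le)
    rw [h1, abs_of_nonneg (mul_nonneg (by positivity) h2)]
    calc (ξ ^ ν) ^ j * ((1 + t) ^ j - 1) ≤ 1 * (2 ^ j * t) := by
          gcongr
          exact one_add_pow_sub_one_le ht0 (by linarith) j
      _ ≤ 1 * (2 ^ (4 * m) * (2 * ((2 : ℚ) ^ (ℓ₂ / m))⁻¹)) := by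
          gcongr
          norm_num
      _ = _ := by rw [pow_succ]; ring
  have hfin := one_le_of_approx (w := w) (k := 4 * m) (N := 2 ^ ℓ₁) (x := X₁ * p ^ a₁)
    (show w < ν by rw [hν]; nlinarith) (by omega) (by positivity)
    (by rw [hξ]; push_cast; field_simp) hq hqu hξ0.le hξ1 hξ3 hδ₂
  exact not_one_le_of_exponents hfin
    (hqle.trans (Nat.pow_le_pow_right (by norm_num) (show _ ≤ ℓ₂ / (256 * m ^ 2) +
      ν * (ℓ₁ / (256 * m ^ 2)) + 4 * m * ℓ₁ + ν by omega)))
    (le_trans (by omega) (hb1.trans hb2)) (le_trans (by omega) (hb1.trans hb3))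

/-! ### Digit sums of powers of 2 -/

/-- The sum of the digits of `n` in base `p`. -/
def digitSum (p n : ℕ) : ℕ := (Nat.digits p n).sum

theorem digitSum_zero (p : ℕ) : digitSum p 0 = 0 := by simp [digitSum]

theorem digitSum_eq_mod_add {p : ℕ} (hp : 1 < p) (n : ℕ) :
    digitSum p n = n % p + digitSum p (n / p) := by
  rcases Nat.eq_zero_or_pos n with rfl | hn
  · simp [digitSum]
  · rw [digitSum, Nat.digits_def' hp hn, List.sum_cons, digitSum]

theorem digitSum_of_lt {p n : ℕ} (hp : 1 < p) (hn : n < p) : digitSum p n = n := by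
  rw [digitSum_eq_mod_add hp, Nat.mod_eq_of_lt hn, Nat.div_eq_of_lt hn, digitSum_zero, add_zero]

theorem digitSum_pos {p n : ℕ} (hn : 0 < n) : 0 < digitSum p n := by
  by_contra h
  have h0 : digitSum p n = 0 := by omega
  rw [digitSum, List.sum_eq_zero_iff] at h0
  exact Nat.getLast_digit_ne_zero p hn.ne' (h0 _ (List.getLast_mem _))

theorem digitSum_mod_add_div {p : ℕ} (hp : 1 < p) (x n : ℕ) :
    digitSum p (n % p ^ x) + digitSum p (n / p ^ x) = digitSum p n := by
  induction x generalizing n with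
  | zero => simp [Nat.mod_one, digitSum_zero]
  | succ x ih =>
    rw [digitSum_eq_mod_add hp (n % p ^ (x + 1)), digitSum_eq_mod_add hp n, ← ih (n / p),
      pow_succ', Nat.mod_mul_right_mod, Nat.mod_mul_right_div_self, Nat.div_div_eq_div_mul, add_assoc]

theorem digitSum_pow_mul {p : ℕ} (hp : 1 < p) (x n : ℕ) :
    digitSum p (p ^ x * n) = digitSum p n := by
  have hpos : 0 < p ^ x := by positivity
  rw [← digitSum_mod_add_div hp x (p ^ x * n), Nat.mul_mod_right, digitSum_zero, zero_add,
    Nat.mul_div_cancel_left _ hpos]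

/-- If each of `J` successive windows of base-`p` positions contains a nonzero digit of `n`, then
the digit sum of `n` is at least `J`. -/
theorem le_digitSum_of_windows {p n J : ℕ} (hp : 1 < p) {x : ℕ → ℕ}
    (hx : ∀ j < J, x j ≤ x (j + 1))
    (hne : ∀ j < J, n % p ^ x (j + 1) ≠ n % p ^ x j) : J ≤ digitSum p (n % p ^ x J) := by
  induction J with
  | zero => exact Nat.zero_le _
  | succ J ih =>
    have h1 := ih (fun j hj => hx j (by omega)) (fun j hj => hne j (by omega))
    have h2 := hx J (by omega)
    have h3 : n % p ^ x (J + 1) % p ^ x J = n % p ^ x J :=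
      Nat.mod_mod_of_dvd _ (pow_dvd_pow p h2)
    rw [← digitSum_mod_add_div hp (x J) (n % p ^ x (J + 1)), h3]
    have h4 : 0 < n % p ^ x (J + 1) / p ^ x J := by
      by_contra h0
      have h0 : n % p ^ x (J + 1) / p ^ x J = 0 :=
        Nat.eq_zero_of_not_pos h0
      have := Nat.mod_add_div (n % p ^ x (J + 1)) (p ^ x J)
      rw [h0, h3, mul_zero, add_zero] at this
      exact hne J (by omega) this.symm
    have := digitSum_pos (p := p) h4
    omega

/-- Denominators of the relative positions that delimit the windows. -/
def windowDenom : ℕ → ℕ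
  | 0 => 2
  | j + 1 => 2048 * windowDenom j ^ 2

theorem two_le_windowDenom (j : ℕ) : 2 ≤ windowDenom j := by
  induction j with
  | zero => exact le_rfl
  | succ j ih => rw [windowDenom]; nlinarith

theorem windowDenom_monotone : Monotone windowDenom :=
  monotone_nat_of_le_succ fun j => by
    rw [windowDenom]; nlinarith [two_le_windowDenom j]

/-- Cut the expansion of `2 ^ ℓ` at the top of a window of zeros: the part above is `X`, the part
below is `Y`, which is nonzero since `p` does not divide `2 ^ ℓ`. -/
theorem mem_nearMultiples_of_window {p ℓ b A : ℕ} (hp : 1 < p) (hcop : ¬ p ∣ 2 ^ ℓ) (hb : 2 ≤ b)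
    (hA₁ : p ^ A ≤ p * 2 ^ ℓ) (hA₂ : 2 ^ ℓ < p ^ A) (hA : 4 * (2048 * b ^ 2) ≤ A)
    (hℓ : p + 2048 * b ^ 2 ≤ ℓ)
    (hwin : 2 ^ ℓ % p ^ (A - A / (2048 * b ^ 2)) = 2 ^ ℓ % p ^ (A - A / b)) :
    ℓ ∈ nearMultiples p (2 * b) (256 * (2 * b) ^ 2) := by
  set b' := 2048 * b ^ 2 with hb'
  have hbb' : b ≤ b' := by rw [hb']; nlinarith
  have hM : 256 * (2 * b) ^ 2 = 1024 * b ^ 2 := by ring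
  rw [hM]
  have hq1 : 1 ≤ A / b' := (Nat.one_le_div_iff (by omega)).mpr (by omega)
  have hq2 : A / b' ≤ A / 2 := Nat.div_le_div_left (by omega) (by norm_num)
  have hq3 : A / b ≤ A / 2 := Nat.div_le_div_left hb (by norm_num)
  have hq4 : A / b * b ≤ A := Nat.div_mul_le_self _ _
  have hq5 : A < b * (A / b + 1) := Nat.lt_mul_div_succ _ (by omega)
  have hq6 : A / b' * b' ≤ A := Nat.div_mul_le_self _ _
  set x := A - A / b' with hx
  have hx1 : 1 ≤ x := by omega
  have hpow : p ^ (A - 1) ≤ 2 ^ ℓ := by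
    have : p * p ^ (A - 1) ≤ p * 2 ^ ℓ := by
      rw [← pow_succ', Nat.sub_add_cancel (by omega)]; exact hA₁
    exact Nat.le_of_mul_le_mul_left this (by omega)
  refine ⟨2 ^ ℓ / p ^ x, x, 2 ^ ℓ % p ^ x, ?_, ?_, ?_, ?_, ?_⟩
  · rw [Nat.div_add_mod']
  · refine Nat.pos_of_ne_zero fun h0 => hcop ?_
    exact (dvd_pow_self p (by omega)).trans (Nat.dvd_of_mod_eq_zero h0)
  · have h1 : 2 ^ ℓ % p ^ x ≤ p ^ (A - A / b) := by
      rw [hwin]; exact (Nat.mod_lt _ (by positivity)).le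
    -- The `- 1` is needed because only `p ^ (A - 1) ≤ 2 ^ ℓ` is known; the 2 in `2 * b` pays for it
    -- and for rounding.
    have h2 : 2 ^ (ℓ / (2 * b)) ≤ p ^ (A / b - 1) := by
      have h3 : (2 ^ (ℓ / (2 * b))) ^ (2 * b) ≤ (p ^ (A / b - 1)) ^ (2 * b) := by
        calc (2 ^ (ℓ / (2 * b))) ^ (2 * b) ≤ 2 ^ ℓ := by
              rw [← pow_mul]
              exact Nat.pow_le_pow_right (by norm_num) (Nat.div_mul_le_self _ _)
          _ ≤ p ^ A := hA₂.le
          _ ≤ (p ^ (A / b - 1)) ^ (2 * b) := by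
              rw [← pow_mul]
              refine Nat.pow_le_pow_right (by omega) ?_
              have h4 : 1 ≤ A / b := (Nat.one_le_div_iff (by omega)).mpr (by omega)
              obtain ⟨c, hc⟩ := Nat.exists_eq_add_of_le h4
              rw [hc] at hq5 ⊢
              rw [Nat.add_sub_cancel_left]
              nlinarith
      exact (Nat.pow_le_pow_iff_left (by omega)).mp h3
    calc _ ≤ p ^ (A - A / b) * p ^ (A / b - 1) := Nat.mul_le_mul h1 h2
      _ = p ^ (A - 1) := by
          rw [← pow_add]; congr 1
          have h4 : 1 ≤ A / b := (Nat.one_le_div_iff (by omega)).mpr (by omega)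
          omega
      _ ≤ 2 ^ ℓ := hpow
  · refine Nat.div_pos (le_trans ?_ hpow) (by positivity)
    exact Nat.pow_le_pow_right (by omega) (by omega)
  · have h1 : 2 ^ ℓ / p ^ x ≤ p ^ (A / b') := by
      refine (Nat.div_lt_of_lt_mul ?_).le
      rw [← pow_add, hx, Nat.sub_add_cancel (by omega)]
      exact hA₂
    refine h1.trans ?_
    -- The extra factor `p` and the floors are absorbed by `b'` being twice `1024 * b ^ 2`.
    have h2 : p ^ A ≤ 2 ^ (p + ℓ) := by
      rw [pow_add]
      exact hA₁.trans (Nat.mul_le_mul_right _ Nat.lt_two_pow_self.le)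
    have h3 : (p ^ (A / b')) ^ b' ≤ (2 ^ (ℓ / (1024 * b ^ 2))) ^ b' := by
      calc (p ^ (A / b')) ^ b' ≤ p ^ A := by
            rw [← pow_mul]; exact Nat.pow_le_pow_right (by omega) hq6
        _ ≤ 2 ^ (p + ℓ) := h2
        _ ≤ _ := by
            rw [← pow_mul]
            refine Nat.pow_le_pow_right (by norm_num) ?_
            have h4 : ℓ < 1024 * b ^ 2 * (ℓ / (1024 * b ^ 2) + 1) :=
              Nat.lt_mul_div_succ _ (by positivity)
            have h5 : b' = 2 * (1024 * b ^ 2) := by rw [hb']; ring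
            rw [h5] at hℓ ⊢
            nlinarith
    exact (Nat.pow_le_pow_iff_left (by omega)).mp h3

/-- With `N + 1` disjoint windows and digit sum at most `N`, some window is empty, so large `ℓ` lies
in one of finitely many finite sets. The recursion for `windowDenom` matches `256 * m ^ 2` at `m = 2
* windowDenom j`. -/
theorem finite_setOf_digitSum_two_pow_le {p : ℕ} (hp : p.Prime) (hodd : Odd p) (N : ℕ) :
    {ℓ : ℕ | digitSum p (2 ^ ℓ) ≤ N}.Finite := by
  have hp1 := hp.one_lt
  set L := 4 * p * windowDenom (N + 1) with hL
  refine ((Set.finite_Iio L).union (Set.Finite.biUnion (Finset.range (N + 1)).finite_toSet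
    fun j _ => finite_nearMultiples hp.pos
      (show 0 < 2 * windowDenom j by have := two_le_windowDenom j; omega))).subset fun ℓ hℓ => ?_
  by_cases hlt : ℓ < L
  · exact Or.inl hlt
  refine Or.inr ?_
  by_contra hnot
  simp only [Set.mem_iUnion, not_exists] at hnot
  set A := Nat.log p (2 ^ ℓ) + 1 with hA
  have hA₂ : 2 ^ ℓ < p ^ A := Nat.lt_pow_succ_log_self hp1 _
  have hA₁ : p ^ A ≤ p * 2 ^ ℓ := by
    rw [hA, pow_succ']
    exact Nat.mul_le_mul_left _ (Nat.pow_log_le_self p (by positivity))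
  have hAℓ : ℓ < p * A := by
    have h1 : 2 ^ ℓ < 2 ^ (p * A) := by
      rw [pow_mul]
      exact hA₂.trans_le (Nat.pow_le_pow_left Nat.lt_two_pow_self.le _)
    exact (Nat.pow_lt_pow_iff_right (by norm_num)).mp h1
  have hAb : 4 * windowDenom (N + 1) ≤ A := by
    have : p * (4 * windowDenom (N + 1)) < p * A := by
      refine lt_of_le_of_lt ?_ hAℓ
      rw [hL] at hlt; linarith
    exact (Nat.lt_of_mul_lt_mul_left this).le
  have hcop : ¬ p ∣ 2 ^ ℓ := fun h => by
    have := (Nat.prime_dvd_prime_iff_eq hp Nat.prime_two).mp (hp.dvd_of_dvd_pow h)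
    subst this
    exact absurd hodd (by decide)
  have hwin := le_digitSum_of_windows (n := 2 ^ ℓ) (J := N + 1) hp1
    (x := fun j => A - A / windowDenom j)
    (fun j _ => by
      have : A / windowDenom (j + 1) ≤ A / windowDenom j := Nat.div_le_div_left
        (windowDenom_monotone (Nat.le_succ j))
        (by have := two_le_windowDenom j; omega)
      omega)
    (fun j hj heq => by
      refine hnot j (by simpa using hj) ?_
      have hmono := windowDenom_monotone (show j + 1 ≤ N + 1 by omega)
      rw [windowDenom] at hmono
      refine mem_nearMultiples_of_window hp1 hcop (two_le_windowDenom j) hA₁ hA₂ (by omega) ?_ heq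
      have h2 := two_le_windowDenom (N + 1)
      have : p + windowDenom (N + 1) ≤ L := by rw [hL]; nlinarith
      omega)
  have := digitSum_mod_add_div hp1 (A - A / windowDenom (N + 1)) (2 ^ ℓ)
  have hℓ' : digitSum p (2 ^ ℓ) ≤ N := hℓ
  omega

/-! ### Denominators of Bernoulli numbers -/

theorem Rat.den_dvd_iff_exists_int {x : ℚ} {d : ℕ} (hd : d ≠ 0) :
    x.den ∣ d ↔ ∃ z : ℤ, (d : ℚ) * x = z := by
  constructor
  · rintro ⟨c, rfl⟩
    refine ⟨c * x.num, ?_⟩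
    push_cast
    rw [mul_right_comm, Rat.den_mul_eq_num, mul_comm]
  · rintro ⟨z, hz⟩
    have hx : x = (z : ℚ) / ((d : ℤ) : ℚ) := by
      rw [eq_div_iff (by exact_mod_cast hd), mul_comm]; exact_mod_cast hz
    have := Rat.den_dvd z d
    rw [← Rat.divInt_eq_div] at hx
    rw [← hx] at this
    exact_mod_cast this

theorem Rat.den_add_of_coprime {x y : ℚ} (h : x.den.Coprime y.den) :
    (x + y).den = x.den * y.den := by
  refine Nat.dvd_antisymm (Rat.add_den_dvd x y) (h.mul_dvd_of_dvd_of_dvd ?_ ?_)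
  · have := Rat.sub_den_dvd (x + y) y
    rw [add_sub_cancel_right] at this
    exact h.dvd_of_dvd_mul_right this
  · have := Rat.sub_den_dvd (x + y) x
    rw [add_sub_cancel_left] at this
    exact h.symm.dvd_of_dvd_mul_right this

theorem den_sum_one_div_primes (S : Finset ℕ) (hS : ∀ p ∈ S, p.Prime) :
    (∑ p ∈ S, (1 : ℚ) / p).den = ∏ p ∈ S, p := by
  induction S using Finset.induction_on with
  | empty => simp
  | insert q S hq ih =>
    have ih := ih fun p hp => hS p (Finset.mem_insert_of_mem hp)
    have hqp := hS q (Finset.mem_insert_self _ _)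
    have hqd : ((1 : ℚ) / q).den = q := by
      rw [one_div]; simp [hqp.ne_zero]
    rw [Finset.sum_insert hq, Finset.prod_insert hq, Rat.den_add_of_coprime, hqd, ih]
    rw [hqd, ih]
    refine Nat.Coprime.prod_right fun p hp => ?_
    rw [Nat.coprime_primes hqp (hS p (Finset.mem_insert_of_mem hp))]
    rintro rfl
    exact hq hp

theorem den_bernoulli_two_mul (k : ℕ) :
    (_root_.bernoulli (2 * k)).den =
      ∏ p ∈ Finset.range (2 * k + 2) with p.Prime ∧ (p - 1) ∣ 2 * k, p := by
  obtain ⟨z, hz⟩ := Bernoulli.vonStaudt_clausen k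
  rw [← sub_eq_iff_eq_add] at hz
  rw [← hz, Rat.intCast_sub_den]
  exact den_sum_one_div_primes _ fun p hp => (Finset.mem_filter.mp hp).2.1

theorem squarefree_den_bernoulli (k : ℕ) : Squarefree (_root_.bernoulli k).den := by
  rcases Nat.even_or_odd' k with ⟨c, rfl | rfl⟩
  · rw [den_bernoulli_two_mul]
    refine Finset.squarefree_prod_of_pairwise_isCoprime (fun p hp q hq hpq => ?_) fun p hp => ?_
    · simp only [Finset.coe_filter, Set.mem_ofPred_eq] at hp hq
      exact Nat.coprime_iff_isRelPrime.mp ((Nat.coprime_primes hp.2.1 hq.2.1).mpr hpq)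
    · exact (Finset.mem_filter.mp hp).2.1.squarefree
  · rcases Nat.eq_zero_or_pos c with rfl | hc
    · norm_num [_root_.bernoulli_one]
      exact Nat.prime_two.squarefree
    · rw [bernoulli_eq_zero_of_odd ⟨c, rfl⟩ (by omega)]
      simp

theorem prime_dvd_den_bernoulli_two_mul {q k : ℕ} (hq : q.Prime) (hk : 0 < k) :
    q ∣ (_root_.bernoulli (2 * k)).den ↔ (q - 1) ∣ 2 * k := by
  rw [den_bernoulli_two_mul, hq.prime.dvd_finsetProd_iff]
  constructor
  · rintro ⟨p, hp, hqp⟩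
    have hp := (Finset.mem_filter.mp hp).2
    rw [(Nat.prime_dvd_prime_iff_eq hq hp.1).mp hqp]
    exact hp.2
  · intro h
    have := Nat.le_of_dvd (by omega) h
    exact ⟨q, Finset.mem_filter.mpr ⟨Finset.mem_range.mpr (by omega), hq, h⟩, dvd_rfl⟩

theorem sub_one_dvd_of_prime_dvd_den_bernoulli {q k : ℕ} (hq : q.Prime)
    (h : q ∣ (_root_.bernoulli k).den) : 0 < k ∧ (q - 1) ∣ k := by
  rcases Nat.even_or_odd' k with ⟨c, rfl | rfl⟩
  · rcases Nat.eq_zero_or_pos c with rfl | hc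
    · rw [mul_zero, _root_.bernoulli_zero] at h
      exact absurd (Nat.dvd_one.mp h) hq.one_lt.ne'
    · exact ⟨by omega, (prime_dvd_den_bernoulli_two_mul hq hc).mp h⟩
  · rcases Nat.eq_zero_or_pos c with rfl | hc
    · have h2 : (_root_.bernoulli (2 * 0 + 1)).den = 2 := by norm_num [_root_.bernoulli_one]
      rw [h2, Nat.prime_dvd_prime_iff_eq hq Nat.prime_two] at h
      subst h
      exact ⟨by omega, by norm_num⟩
    · rw [bernoulli_eq_zero_of_odd ⟨c, rfl⟩ (by omega)] at h
      exact absurd (Nat.dvd_one.mp h) hq.one_lt.ne'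

/-- Squarefreeness matters: `q` occurs at most once in the denominator, so a single factor `q` of
`c` removes it. -/
theorem prime_dvd_den_mul_natCast {q c : ℕ} {x : ℚ} (hq : q.Prime) (hc : c ≠ 0)
    (hx : Squarefree x.den) : q ∣ (x * c).den ↔ q ∣ x.den ∧ ¬ q ∣ c := by
  have hdvd : (x * c).den ∣ x.den := by
    have := Rat.mul_den_dvd x c
    rwa [Rat.den_natCast, mul_one] at this
  constructor
  · intro h
    have hqx := h.trans hdvd
    refine ⟨hqx, fun hqc => ?_⟩
    obtain ⟨e, he⟩ := hqx
    obtain ⟨c', rfl⟩ := hqc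
    have he0 : e ≠ 0 := by rintro rfl; exact x.den_ne_zero (by rw [he, mul_zero])
    have h1 : (x * ((q * c' : ℕ) : ℚ)).den ∣ e := by
      rw [Rat.den_dvd_iff_exists_int he0]
      refine ⟨x.num * c', ?_⟩
      have := Rat.den_mul_eq_num x
      rw [he] at this
      push_cast at this ⊢
      rw [← this]; ring
    have h2 : q * q ∣ x.den := by rw [he]; exact Nat.mul_dvd_mul_left q (h.trans h1)
    exact hq.one_lt.ne' (Nat.isUnit_iff.mp (hx q h2))
  · rintro ⟨h1, h2⟩
    have h3 : x.den ∣ (x * c).den * c := by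
      rw [Rat.den_dvd_iff_exists_int (Nat.mul_ne_zero (Rat.den_ne_zero _) hc)]
      refine ⟨(x * c).num, ?_⟩
      rw [← Rat.den_mul_eq_num (x * c)]
      push_cast; ring
    exact (hq.dvd_mul.mp (h1.trans h3)).resolve_right h2

/-! ### Carries, binomial coefficients and the denominator of `B_n(x) - B_n` -/

theorem digitSum_add_mul {p a : ℕ} (hp : 1 < p) (ha : a < p) (b : ℕ) :
    digitSum p (a + p * b) = a + digitSum p b := by
  rw [digitSum_eq_mod_add hp, Nat.add_mul_mod_self_left, Nat.mod_eq_of_lt ha,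
    Nat.add_mul_div_left _ _ (by omega), Nat.div_eq_of_lt ha, zero_add]

/-- Take units away from the digits of `n`, starting at the lowest, until `r` have been collected;
the two parts then add without carry. -/
theorem exists_add_eq_digitSum_eq {p : ℕ} (hp : 1 < p) (n r : ℕ) (hr : r ≤ digitSum p n) :
    ∃ k l, k + l = n ∧ digitSum p k = r ∧ digitSum p k + digitSum p l = digitSum p n := by
  induction n using Nat.strong_induction_on generalizing r with
  | _ n ih =>
    rcases Nat.eq_zero_or_pos n with rfl | hn
    · rw [digitSum_zero] at hr
      exact ⟨0, 0, rfl, by rw [digitSum_zero]; omega, by rw [digitSum_zero]⟩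
    · have hmod := Nat.mod_lt n (show p > 0 by omega)
      have hdiv := Nat.mod_add_div n p
      have hs := digitSum_eq_mod_add hp n
      rcases le_or_gt r (n % p) with h | h
      · refine ⟨r, (n % p - r) + p * (n / p), by omega, digitSum_of_lt hp (by omega), ?_⟩
        rw [digitSum_of_lt hp (by omega), digitSum_add_mul hp (by omega)]
        omega
      · obtain ⟨k, l, h1, h2, h3⟩ := ih (n / p) (Nat.div_lt_self hn hp) (r - n % p) (by omega)
        refine ⟨n % p + p * k, p * l, ?_, ?_, ?_⟩
        · rw [add_assoc, ← mul_add, h1, hdiv]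
        · rw [digitSum_add_mul hp hmod]; omega
        · have := digitSum_add_mul hp (show 0 < p by omega) l
          rw [zero_add, zero_add] at this
          rw [digitSum_add_mul hp hmod, this]; omega

theorem digitSum_add_le_of_not_dvd_choose {q k n : ℕ} (hq : q.Prime) (hkn : k ≤ n)
    (h : ¬ q ∣ n.choose k) : digitSum q k + digitSum q (n - k) ≤ digitSum q n := by
  have := Fact.mk hq
  have h1 := sub_one_mul_padicValNat_choose_eq_sub_sum_digits (p := q) hkn
  rw [padicValNat.eq_zero_of_not_dvd h, mul_zero] at h1
  simp only [digitSum]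
  omega

theorem not_dvd_choose_of_digitSum_add_eq {q k n : ℕ} (hq : q.Prime) (hkn : k ≤ n)
    (h : digitSum q k + digitSum q (n - k) = digitSum q n) : ¬ q ∣ n.choose k := by
  have := Fact.mk hq
  have h1 := sub_one_mul_padicValNat_choose_eq_sub_sum_digits (p := q) hkn
  simp only [digitSum] at h
  rw [h, Nat.sub_self, Nat.mul_eq_zero] at h1
  have h2 := hq.two_le
  rcases h1 with h1 | h1
  · omega
  · intro hd
    have := one_le_padicValNat_of_dvd (Nat.choose_pos hkn).ne' hd
    omega

theorem sub_one_dvd_iff_dvd_digitSum {q : ℕ} (k : ℕ) (hq : 1 < q) :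
    (q - 1) ∣ k ↔ (q - 1) ∣ digitSum q k := by
  rcases (show q = 2 ∨ 2 < q by omega) with rfl | h2
  · simp
  · have h : q % (q - 1) = 1 := by
      rw [Nat.mod_eq_sub_mod (by omega), Nat.sub_sub_self (by omega), Nat.mod_eq_of_lt (by omega)]
    exact (Nat.modEq_digits_sum (q - 1) q h k).dvd_iff dvd_rfl

/-- A prime `q` divides the denominator of some non-constant coefficient of the `n`-th Bernoulli
polynomial if and only if the digits of `n` in base `q` sum to at least `q`. -/
theorem exists_prime_dvd_den_coeff_iff {q n : ℕ} (hq : q.Prime) :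
    (∃ k < n, q ∣ (_root_.bernoulli k * (n.choose k : ℚ)).den) ↔ q ≤ digitSum q n := by
  have hcoef : ∀ k < n, q ∣ (_root_.bernoulli k * (n.choose k : ℚ)).den ↔
      q ∣ (_root_.bernoulli k).den ∧ ¬ q ∣ n.choose k := fun k hk =>
    prime_dvd_den_mul_natCast hq (Nat.choose_pos hk.le).ne' (squarefree_den_bernoulli k)
  have hq1 := hq.one_lt
  constructor
  · rintro ⟨k, hk, hdvd⟩
    obtain ⟨h1, h2⟩ := (hcoef k hk).mp hdvd
    obtain ⟨hk0, hk1⟩ := sub_one_dvd_of_prime_dvd_den_bernoulli hq h1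
    have h3 := digitSum_add_le_of_not_dvd_choose hq hk.le h2
    have h4 := Nat.le_of_dvd (digitSum_pos hk0) ((sub_one_dvd_iff_dvd_digitSum k hq1).mp hk1)
    have h5 := digitSum_pos (p := q) (show 0 < n - k by omega)
    omega
  · intro h
    -- Digit sum `q - 1` gives `q - 1 ∣ k`, and the absence of carries gives `q ∤ n.choose k`.
    obtain ⟨k, l, hkl, hsk, hsum⟩ := exists_add_eq_digitSum_eq hq1 n (q - 1) (by omega)
    have hl : l ≠ 0 := by rintro rfl; rw [digitSum_zero] at hsum; omega
    have hk0 : k ≠ 0 := by rintro rfl; rw [digitSum_zero] at hsk; omega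
    have hk : k < n := by omega
    have hnk : n - k = l := by omega
    have hch := not_dvd_choose_of_digitSum_add_eq hq hk.le (by rw [hnk]; exact hsum)
    have hdvd : (q - 1) ∣ k := (sub_one_dvd_iff_dvd_digitSum k hq1).mpr (by rw [hsk])
    rcases Nat.even_or_odd' k with ⟨c, rfl | rfl⟩
    · exact ⟨2 * c, hk, (hcoef _ hk).mpr
        ⟨(prime_dvd_den_bernoulli_two_mul hq (by omega)).mpr hdvd, hch⟩⟩
    -- An odd index is possible only for `q = 2`. Then `n` must be odd, and the index 1 with `B₁ =
    -- -1/2` serves instead.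
    · have hq2 : q = 2 := by
        rcases hq.eq_two_or_odd' with h2 | ⟨t, ht⟩
        · exact h2
        · have : 2 ∣ 2 * c + 1 := Dvd.dvd.trans ⟨t, by omega⟩ hdvd
          omega
      subst hq2
      have hn : ¬ 2 ∣ n := by
        intro h2n
        have h6 := Nat.add_one_mul_choose_eq (n - 1) (2 * c)
        rw [Nat.sub_add_cancel (by omega)] at h6
        have h7 : 2 ∣ n.choose (2 * c + 1) * (2 * c + 1) := by
          rw [← h6]; exact h2n.mul_right _
        exact (Nat.prime_two.dvd_mul.mp h7).elim hch (by omega)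
      have h1n : 1 < n := by omega
      refine ⟨1, h1n, (hcoef 1 h1n).mpr ⟨?_, by rwa [Nat.choose_one_right]⟩⟩
      norm_num [_root_.bernoulli_one]

theorem clearsDenom_iff {f : ℚ[X]} {d : ℕ} :
    ClearsDenom f d ↔ 0 < d ∧ ∀ i, (f.coeff i).den ∣ d := by
  refine and_congr_right fun hd => ?_
  have h1 : (∃ g : ℤ[X], g.map (Int.castRingHom ℚ) = C (d : ℚ) * f) ↔
      C (d : ℚ) * f ∈ Polynomial.lifts (Int.castRingHom ℚ) := by
    rw [Polynomial.mem_lifts]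
  rw [h1, Polynomial.lifts_iff_coeff_lifts]
  refine forall_congr' fun i => ?_
  rw [coeff_C_mul, Rat.den_dvd_iff_exists_int hd.ne']
  exact ⟨fun ⟨z, hz⟩ => ⟨z, hz.symm⟩, fun ⟨z, hz⟩ => ⟨z, hz.symm⟩⟩

/-- The denominator of `B_n(x) - B_n` is the product of the primes `q` for which the base-`q`
digits of `n` sum to at least `q`. -/
theorem bernDenom_eq_prod {n N : ℕ} (hN : n ≤ N) :
    bernDenom n = ∏ q ∈ Finset.range (N + 1) with q.Prime ∧ q ≤ digitSum q n, q := by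
  set D := ∏ q ∈ Finset.range (N + 1) with q.Prime ∧ q ≤ digitSum q n, q with hD
  have hcoeff : ∀ i, (Polynomial.bernoulli n - C (_root_.bernoulli n)).coeff i =
      if 0 < i ∧ i ≤ n then _root_.bernoulli (n - i) * (n.choose (n - i) : ℚ) else 0 := by
    intro i
    rw [coeff_sub, coeff_bernoulli, coeff_C]
    rcases Nat.eq_zero_or_pos i with rfl | hi
    · simp
    · by_cases hin : i ≤ n
      · rw [if_pos hin, if_neg hi.ne', if_pos ⟨hi, hin⟩, sub_zero, Nat.choose_symm hin]
      · rw [if_neg hin, if_neg hi.ne', if_neg (by tauto), sub_zero]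
  have hDpos : 0 < D := Finset.prod_pos fun q hq => (Finset.mem_filter.mp hq).2.1.pos
  refine le_antisymm ?_ ?_
  · refine (polyDenom_isLeast _).2 (clearsDenom_iff.mpr ⟨hDpos, fun i => ?_⟩)
    rw [hcoeff]
    split_ifs with hi
    · set x := _root_.bernoulli (n - i) with hx
      set c := n.choose (n - i)
      have hsq : Squarefree (x * (c : ℚ)).den := by
        refine Squarefree.squarefree_of_dvd ?_ (squarefree_den_bernoulli (n - i))
        have := Rat.mul_den_dvd x c
        rwa [Rat.den_natCast, mul_one] at this
      rw [← Nat.prod_primeFactors_of_squarefree hsq]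
      refine Finset.prod_dvd_prod_of_subset _ _ _ fun q hq => ?_
      have hqp := Nat.prime_of_mem_primeFactors hq
      have hle := (exists_prime_dvd_den_coeff_iff (n := n) hqp).mp
        ⟨n - i, by omega, Nat.dvd_of_mem_primeFactors hq⟩
      refine Finset.mem_filter.mpr ⟨Finset.mem_range.mpr ?_, hqp, hle⟩
      have : digitSum q n ≤ n := Nat.digit_sum_le q n
      omega
    · simp
  · obtain ⟨hpos, hall⟩ := clearsDenom_iff.mp (polyDenom_isLeast
      (Polynomial.bernoulli n - C (_root_.bernoulli n))).1
    refine Nat.le_of_dvd hpos (Finset.prod_primes_dvd _ (fun q hq => ?_) fun q hq => ?_)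
    · exact (Finset.mem_filter.mp hq).2.1.prime
    · obtain ⟨-, hqp, hle⟩ := Finset.mem_filter.mp hq
      obtain ⟨k, hk, hdvd⟩ := (exists_prime_dvd_den_coeff_iff hqp).mpr hle
      have := hall (n - k)
      rw [hcoeff, if_pos ⟨by omega, by omega⟩, Nat.sub_sub_self hk.le] at this
      exact hdvd.trans this

/-! ### Passing from `n` to `n + 1` -/

theorem digitSum_succ_of_not_dvd {q n : ℕ} (hq : 1 < q) (h : ¬ q ∣ n + 1) :
    digitSum q (n + 1) = digitSum q n + 1 := by
  have hmod := Nat.mod_lt n (show q > 0 by omega)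
  have hdiv := Nat.mod_add_div n q
  have hlt : n % q + 1 < q := by
    by_contra hge
    have h1 : n % q + 1 = q := by omega
    exact h ⟨n / q + 1, by rw [mul_add, mul_one]; omega⟩
  conv_lhs => rw [show n + 1 = (n % q + 1) + q * (n / q) by omega]
  rw [digitSum_add_mul hq hlt, digitSum_eq_mod_add hq n]
  ring

theorem digitSum_succ_le {q : ℕ} (hq : 1 < q) (n : ℕ) : digitSum q (n + 1) ≤ digitSum q n + 1 := by
  induction n using Nat.strong_induction_on with
  | _ n ih =>
    by_cases h : q ∣ n + 1
    · obtain ⟨m, hm⟩ := h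
      obtain ⟨m, rfl⟩ : ∃ m', m = m' + 1 := ⟨m - 1, by
        have : m ≠ 0 := by rintro rfl; omega
        omega⟩
      have hn : n = (q - 1) + q * m := by rw [mul_add, mul_one] at hm; omega
      have hmn : m < n := by nlinarith
      have h1 := digitSum_pow_mul hq 1 (m + 1)
      rw [pow_one] at h1
      have h2 := digitSum_add_mul hq (show q - 1 < q by omega) m
      rw [hm, h1, hn, h2]
      have := ih m hmn
      omega
    · exact (digitSum_succ_of_not_dvd hq h).le

/-- The last digit `q - 1` turns into 0, and the carry adds at most 1 to the digit sum of the rest.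
-/
theorem digitSum_succ_add_le_of_dvd {q n : ℕ} (hq : 1 < q) (h : q ∣ n + 1) :
    digitSum q (n + 1) + (q - 1) ≤ digitSum q n + 1 := by
  obtain ⟨m, hm⟩ := h
  obtain ⟨m, rfl⟩ : ∃ m', m = m' + 1 := ⟨m - 1, by
    have : m ≠ 0 := by rintro rfl; omega
    omega⟩
  have hn : n = (q - 1) + q * m := by rw [mul_add, mul_one] at hm; omega
  have h1 := digitSum_pow_mul hq 1 (m + 1)
  rw [pow_one] at h1
  have h2 := digitSum_add_mul hq (show q - 1 < q by omega) m
  rw [hm, h1, hn, h2]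
  have := digitSum_succ_le hq m
  omega

theorem eq_pow_of_digitSum_eq_one {q m : ℕ} (hq : 1 < q) (h : digitSum q m = 1) :
    ∃ k, m = q ^ k := by
  induction m using Nat.strong_induction_on with
  | _ m ih =>
    have hm : 0 < m := by
      rcases Nat.eq_zero_or_pos m with rfl | hm
      · rw [digitSum_zero] at h; omega
      · exact hm
    have hdiv := Nat.mod_add_div m q
    have hs := digitSum_eq_mod_add hq m
    rcases Nat.eq_zero_or_pos (m / q) with h0 | h0
    · rw [h0, digitSum_zero] at hs
      rw [h0] at hdiv
      exact ⟨0, by rw [pow_zero]; omega⟩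
    · have h1 := digitSum_pos (p := q) h0
      obtain ⟨k, hk⟩ := ih (m / q) (Nat.div_lt_self hm hq) (by omega)
      exact ⟨k + 1, by rw [pow_succ', ← hk]; omega⟩

/-- The primes dividing `bernDenom n` but not `bernDenom (n + 1)`, for odd `n`. -/
def quotientPrimes (n : ℕ) : Finset ℕ :=
  {q ∈ Finset.range (n + 2) | q.Prime ∧ q ∣ n + 1 ∧ digitSum q (n + 1) < q ∧ q ≤ digitSum q n}

theorem mem_quotientPrimes {n q : ℕ} : q ∈ quotientPrimes n ↔
    q.Prime ∧ q ∣ n + 1 ∧ digitSum q (n + 1) < q ∧ q ≤ digitSum q n := by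
  rw [quotientPrimes, Finset.mem_filter, Finset.mem_range, and_iff_right_iff_imp]
  rintro ⟨-, h, -⟩
  have := Nat.le_of_dvd (by omega) h
  omega

/-- A prime `q` new in `𝔇_{n+1}` would need `q ∤ n + 1` and `s_q(n) = q - 1`, hence `q - 1 ∣ n`; for
odd `n` this excludes odd `q`, while 2 divides `n + 1`. So primes only drop out, and those that do
divide `n + 1`. -/
theorem bernDenomRatio_eq_prod {n : ℕ} (hn : Odd n) :
    bernDenomRatio n = ((∏ q ∈ quotientPrimes n, q : ℕ) : ℚ) := by
  have hA := bernDenom_eq_prod (show n ≤ n + 1 by omega)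
  have hB := bernDenom_eq_prod (le_refl (n + 1))
  set A := {q ∈ Finset.range (n + 1 + 1) | q.Prime ∧ q ≤ digitSum q n}
  set B := {q ∈ Finset.range (n + 1 + 1) | q.Prime ∧ q ≤ digitSum q (n + 1)} with hBdef
  have hBA : B ⊆ A := by
    intro q hq
    obtain ⟨hr, hp, hle⟩ := Finset.mem_filter.mp hq
    refine Finset.mem_filter.mpr ⟨hr, hp, ?_⟩
    have h2 := hp.two_le
    by_cases hd : q ∣ n + 1
    · have := digitSum_succ_add_le_of_dvd hp.one_lt hd
      omega
    · have hs := digitSum_succ_of_not_dvd hp.one_lt hd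
      by_contra hlt
      have hdvd : (q - 1) ∣ n :=
        (sub_one_dvd_iff_dvd_digitSum n hp.one_lt).mpr ⟨1, by omega⟩
      rcases hp.eq_two_or_odd' with rfl | ⟨t, ht⟩
      · exact hd (even_iff_two_dvd.mp hn.add_one)
      · have : 2 ∣ n := Dvd.dvd.trans ⟨t, by omega⟩ hdvd
        exact (Nat.not_even_iff_odd.mpr hn) (even_iff_two_dvd.mpr this)
  have hsdiff : A \ B = quotientPrimes n := by
    ext q
    rw [Finset.mem_sdiff, mem_quotientPrimes]
    constructor
    · rintro ⟨hqA, hqB⟩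
      obtain ⟨hr, hp, hle⟩ := Finset.mem_filter.mp hqA
      have hlt : digitSum q (n + 1) < q := by
        by_contra h
        exact hqB (Finset.mem_filter.mpr ⟨hr, hp, by omega⟩)
      refine ⟨hp, ?_, hlt, hle⟩
      by_contra hd
      have := digitSum_succ_of_not_dvd hp.one_lt hd
      omega
    · rintro ⟨hp, hd, hlt, hle⟩
      have := Nat.le_of_dvd (by omega) hd
      refine ⟨Finset.mem_filter.mpr ⟨Finset.mem_range.mpr (by omega), hp, hle⟩, fun h => ?_⟩
      have := (Finset.mem_filter.mp h).2.2
      omega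
  have hBne : ((∏ q ∈ B, q : ℕ) : ℚ) ≠ 0 := by
    refine Nat.cast_ne_zero.mpr (Finset.prod_ne_zero_iff.mpr fun q hq => ?_)
    exact (Finset.mem_filter.mp hq).2.1.ne_zero
  rw [bernDenomRatio, hA, hB, div_eq_iff hBne, ← hsdiff, ← Nat.cast_mul, Finset.prod_sdiff hBA]

theorem two_mem_quotientPrimes_iff {n : ℕ} :
    2 ∈ quotientPrimes n ↔ ∃ k, 2 ≤ k ∧ n = 2 ^ k - 1 := by
  rw [mem_quotientPrimes]
  constructor
  · rintro ⟨-, -, hlt, hle⟩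
    have h1 := digitSum_pos (p := 2) (show 0 < n + 1 by omega)
    obtain ⟨k, hk⟩ := eq_pow_of_digitSum_eq_one (q := 2) (m := n + 1) one_lt_two (by omega)
    refine ⟨k, ?_, by omega⟩
    by_contra hk2
    have : n = 0 ∨ n = 1 := by
      rcases (show k = 0 ∨ k = 1 by omega) with rfl | rfl <;> omega
    rcases this with rfl | rfl
    · rw [digitSum_zero] at hle; omega
    · rw [digitSum_of_lt one_lt_two one_lt_two] at hle; omega
  · rintro ⟨k, hk, rfl⟩
    obtain ⟨j, rfl⟩ := Nat.exists_eq_add_of_le hk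
    have hpos : 0 < 2 ^ j := by positivity
    have e1 : 2 ^ (2 + j) - 1 + 1 = 2 ^ (2 + j) * 1 := by
      have : 0 < 2 ^ (2 + j) := by positivity
      omega
    have e2 : 2 ^ (2 + j) - 1 = 1 + 2 * (2 * 2 ^ j - 1) := by rw [pow_add]; omega
    refine ⟨Nat.prime_two, ?_, ?_, ?_⟩
    · rw [e1, mul_one]; exact dvd_pow_self 2 (by omega)
    · rw [e1, digitSum_pow_mul one_lt_two, digitSum_of_lt one_lt_two one_lt_two]; omega
    · rw [e2, digitSum_add_mul one_lt_two one_lt_two]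
      have := digitSum_pos (p := 2) (show 0 < 2 * 2 ^ j - 1 by omega)
      omega

theorem odd_bernDenomRatio_of_two_notMem {n : ℕ} (hn : Odd n) (h : 2 ∉ quotientPrimes n) :
    ∃ q : ℕ, Odd q ∧ bernDenomRatio n = (q : ℚ) := by
  refine ⟨_, ?_, bernDenomRatio_eq_prod hn⟩
  refine Finset.prod_induction _ Odd (fun _ _ => Odd.mul) odd_one fun q hq => ?_
  rcases (mem_quotientPrimes.mp hq).1.eq_two_or_odd' with rfl | h2
  · exact absurd hq h
  · exact h2

theorem bernDenomRatio_two_pow_sub_one {k : ℕ} (hk : 2 ≤ k) : bernDenomRatio (2 ^ k - 1) = 2 := by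
  have hpos : 0 < 2 ^ k := by positivity
  have hT : quotientPrimes (2 ^ k - 1) = {2} := by
    refine Finset.eq_singleton_iff_unique_mem.mpr
      ⟨two_mem_quotientPrimes_iff.mpr ⟨k, hk, rfl⟩, fun q hq => ?_⟩
    obtain ⟨hp, hd, -⟩ := mem_quotientPrimes.mp hq
    rw [Nat.sub_add_cancel hpos] at hd
    exact (Nat.prime_dvd_prime_iff_eq hp Nat.prime_two).mp (hp.dvd_of_dvd_pow hd)
  have hodd : Odd (2 ^ k - 1) :=
    Nat.Even.sub_odd hpos (Nat.even_pow.mpr ⟨even_two, by omega⟩) odd_one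
  rw [bernDenomRatio_eq_prod hodd, hT, Finset.prod_singleton]
  norm_num

theorem bernDenomRatio_two_pow_mul_prime_pow {p : ℕ} (hp : p.Prime) (hodd : Odd p) {k ℓ : ℕ}
    (hk : 1 ≤ k) (hℓ : 1 ≤ ℓ) :
    bernDenomRatio (2 ^ ℓ * p ^ k - 1) = if digitSum p (2 ^ ℓ) < p then (p : ℚ) else 1 := by
  set n := 2 ^ ℓ * p ^ k - 1 with hn
  have hp0 := hp.pos
  have hpos : 0 < 2 ^ ℓ * p ^ k := by positivity
  have hn1 : n + 1 = 2 ^ ℓ * p ^ k := by omega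
  have hp2 : p ≠ 2 := by rintro rfl; exact absurd hodd (by decide)
  have hnodd : Odd n := Nat.Even.sub_odd hpos
    ((Nat.even_pow.mpr ⟨even_two, by omega⟩).mul_right _) odd_one
  have hcop : ∀ j, ¬ p ∣ 2 ^ j := fun j h =>
    hp2 ((Nat.prime_dvd_prime_iff_eq hp Nat.prime_two).mp (hp.dvd_of_dvd_pow h))
  have h2 : 2 ∉ quotientPrimes n := by
    rw [two_mem_quotientPrimes_iff]
    rintro ⟨j, hj, hnj⟩
    have hpj : 0 < 2 ^ j := by positivity
    have : 2 ^ j = 2 ^ ℓ * p ^ k := by omega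
    exact hcop j (this ▸ (dvd_pow_self p (by omega)).mul_left _)
  have hsub : ∀ q ∈ quotientPrimes n, q = p := by
    intro q hq
    obtain ⟨hqp, hd, -⟩ := mem_quotientPrimes.mp hq
    rw [hn1] at hd
    rcases hqp.dvd_mul.mp hd with h | h
    · have := (Nat.prime_dvd_prime_iff_eq hqp Nat.prime_two).mp (hqp.dvd_of_dvd_pow h)
      subst this
      exact absurd hq h2
    · exact (Nat.prime_dvd_prime_iff_eq hqp hp).mp (hqp.dvd_of_dvd_pow h)
  have hs : digitSum p (n + 1) = digitSum p (2 ^ ℓ) := by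
    rw [hn1, mul_comm, digitSum_pow_mul hp.one_lt]
  have hmem : p ∈ quotientPrimes n ↔ digitSum p (2 ^ ℓ) < p := by
    rw [mem_quotientPrimes, hs]
    refine ⟨fun h => h.2.2.1, fun h => ?_⟩
    have hd : p ∣ n + 1 := by rw [hn1]; exact (dvd_pow_self p (by omega)).mul_left _
    refine ⟨hp, hd, h, ?_⟩
    have h3 := digitSum_succ_add_le_of_dvd hp.one_lt hd
    have h4 := digitSum_pos (p := p) (show 0 < 2 ^ ℓ by positivity)
    -- A digit sum of at least 2 for `n + 1` makes that of `n` at least `p`, by `h3`.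
    have h5 : digitSum p (2 ^ ℓ) ≠ 1 := by
      intro h1
      obtain ⟨j, hj⟩ := eq_pow_of_digitSum_eq_one hp.one_lt h1
      rcases Nat.eq_zero_or_pos j with rfl | hj0
      · have := Nat.one_lt_two_pow (n := ℓ) (by omega)
        rw [pow_zero] at hj
        omega
      · exact hcop ℓ (hj ▸ dvd_pow_self p (by omega))
    omega
  rw [bernDenomRatio_eq_prod hnodd]
  split_ifs with h
  · rw [Finset.eq_singleton_iff_unique_mem.mpr ⟨hmem.mpr h, hsub⟩, Finset.prod_singleton]
  · have : quotientPrimes n = ∅ := Finset.eq_empty_of_forall_notMem fun q hq =>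
      h (hmem.mp (hsub q hq ▸ hq))
    rw [this, Finset.prod_empty, Nat.cast_one]

theorem theorem4 :
    -- the first quotients, for `n = 1, 3, 5, …, 41`
    (List.range 21).map (fun i => bernDenomRatio (2 * i + 1)) =
      [1, 2, 3, 2, 5, 3, 7, 2, 3, 5, 11, 1, 13, 7, 15, 2, 17, 3, 19, 5, 7] ∧
    -- for odd `n` the quotient is an odd integer, or else it is `2`
    (∀ n : ℕ, Odd n →
      ((∃ q : ℕ, Odd q ∧ bernDenomRatio n = (q : ℚ)) ∨ bernDenomRatio n = 2) ∧
      (bernDenomRatio n = 2 ↔ ∃ k : ℕ, 2 ≤ k ∧ n = 2 ^ k - 1)) ∧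
    -- the case `n = 2 ^ ℓ * p ^ k - 1`
    (∀ p : ℕ, p.Prime → Odd p →
      (∀ k ℓ : ℕ, 1 ≤ k → 1 ≤ ℓ →
        bernDenomRatio (2 ^ ℓ * p ^ k - 1) = 1 ∨
        bernDenomRatio (2 ^ ℓ * p ^ k - 1) = (p : ℚ)) ∧
      (∀ k ℓ : ℕ, 1 ≤ k → 1 ≤ ℓ → (ℓ : ℝ) < Real.logb 2 (p : ℝ) →
        bernDenomRatio (2 ^ ℓ * p ^ k - 1) = (p : ℚ)) ∧
      (∃ L : ℕ, Real.logb 2 (p : ℝ) < (L : ℝ) ∧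
        ∀ k ℓ : ℕ, 1 ≤ k → L ≤ ℓ →
          bernDenomRatio (2 ^ ℓ * p ^ k - 1) = 1)) := by
  refine ⟨?_, fun n hn => ?_, fun p hp hodd => ⟨fun k ℓ hk hℓ => ?_, fun k ℓ hk hℓ hlt => ?_, ?_⟩⟩
  · have h1 : (List.range 21).map (fun i => bernDenomRatio (2 * i + 1)) =
        ((List.range 21).map fun i => ∏ q ∈ quotientPrimes (2 * i + 1), q).map
          (Nat.cast : ℕ → ℚ) := by
      rw [List.map_map]
      exact List.map_congr_left fun i _ => bernDenomRatio_eq_prod ⟨i, rfl⟩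
    have h2 : ((List.range 21).map fun i => ∏ q ∈ quotientPrimes (2 * i + 1), q) =
        [1, 2, 3, 2, 5, 3, 7, 2, 3, 5, 11, 1, 13, 7, 15, 2, 17, 3, 19, 5, 7] := by
      decide +kernel
    rw [h1, h2]
    norm_num
  · have hiff : bernDenomRatio n = 2 ↔ ∃ k : ℕ, 2 ≤ k ∧ n = 2 ^ k - 1 := by
      refine ⟨fun h => ?_, ?_⟩
      · by_contra hno
        obtain ⟨q, hq, hqn⟩ := odd_bernDenomRatio_of_two_notMem hn
          (fun h2 => hno (two_mem_quotientPrimes_iff.mp h2))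
        rw [h] at hqn
        have : q = 2 := by exact_mod_cast hqn.symm
        subst this
        exact absurd hq (by decide)
      · rintro ⟨k, hk, rfl⟩
        exact bernDenomRatio_two_pow_sub_one hk
    refine ⟨?_, hiff⟩
    by_cases h2 : 2 ∈ quotientPrimes n
    · exact Or.inr (hiff.mpr (two_mem_quotientPrimes_iff.mp h2))
    · exact Or.inl (odd_bernDenomRatio_of_two_notMem hn h2)
  · rw [bernDenomRatio_two_pow_mul_prime_pow hp hodd hk hℓ]
    split_ifs
    · exact Or.inr rfl
    · exact Or.inl rfl
  · rw [bernDenomRatio_two_pow_mul_prime_pow hp hodd hk hℓ, if_pos]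
    rw [Real.lt_logb_iff_rpow_lt one_lt_two (by exact_mod_cast hp.pos), Real.rpow_natCast] at hlt
    have hlt : 2 ^ ℓ < p := by exact_mod_cast hlt
    rwa [digitSum_of_lt hp.one_lt hlt]
  · obtain ⟨M, hM⟩ := (finite_setOf_digitSum_two_pow_le hp hodd (p - 1)).bddAbove
    -- `M + 1` passes the last exponent with digit sum below `p`; adding `p` secures the bound by
    -- `log₂ p`.
    refine ⟨M + 1 + p, ?_, fun k ℓ hk hℓ => ?_⟩
    · rw [Real.logb_lt_iff_lt_rpow one_lt_two (by exact_mod_cast hp.pos), Real.rpow_natCast]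
      have : p < 2 ^ (M + 1 + p) :=
        Nat.lt_two_pow_self.trans_le (Nat.pow_le_pow_right (by norm_num) (by omega))
      exact_mod_cast this
    · rw [bernDenomRatio_two_pow_mul_prime_pow hp hodd hk (by omega), if_neg]
      intro hlt
      have hmem : ℓ ∈ {ℓ : ℕ | digitSum p (2 ^ ℓ) ≤ p - 1} := by
        change digitSum p (2 ^ ℓ) ≤ p - 1
        omega
      have := hM hmem
      omega
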